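/- Call the elements of Cantor space $2^\omega$ reals. An infinite time Turing machine has one-way infinite tapes for oracle, input, scratch work and output, with $0$ or $1$ in each cell, and one head that reads the cells at its position on all of them and can write on the last three. A program is a finite transition table on finitely many states, among them the distinct states *start*, *limit* and *halt*. At stage $0$ the machine is in the start state, with the head on the leftmost cell, an oracle real $z$ on the oracle tape, the input real $x$ on the input tape and zeros on the other two tapes. Successor stages are ordinary Turing machine steps, in which the head moves one cell right or left (staying in place if told to move left from the leftmost cell). At a limit ordinal stage the machine enters the limit state, the head returns to the leftmost cell, and every cell takes the $\limsup$ of its earlier values. Computation ceases when the halt state is entered (from then on the output tape is unchanged), and the output is then the content of the output tape. Write $\varphi_p^z(x)\!\downarrow$ if program $p$ with oracle $z$ on input $x$ halts, and $\varphi_p^z(x)=y$ if it halts with output $y$. For reals $y,z$ write $y\le_\infty z$ if $\varphi_p^z(0)=y$ for some program $p$, where $0$ is the constantly zero real, and $y\equiv_\infty z$ if $y\le_\infty z$ and $z\le_\infty y$. Identify programs with natural numbers by a standard Gödel numbering, and a natural number $n$, as an input, with the real $1^n000\cdots$. The lightface infinite time jump of a real $x$ is $x^{\triangledown}=\{p :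 \varphi_p^x(p)\!\downarrow\}\subseteq\omega$, viewed as a real. The jump equivalence relation $J$ is defined by $x\mathrel{J}y$ if and only if $x^{\triangledown}\equiv_\infty y^{\triangledown}$. A function $f\colon 2^\omega\to 2^\omega$ is eventually computable if there are a program $p$ and a real parameter $z$ such that for every real $x$, in the computation of $p$ with oracle $z$ on input $x$, the output tape shows $f(x)$ at all stages from some ordinal stage on (whether or not the computation halts). A relation $E$ on the reals is eventually reducible to a relation $F$ by $f$ if $f$ is eventually computable and, for all reals $x,y$, $x\mathrel{E}y$ if and only if $f(x)\mathrel{F}f(y)$; it is eventually reducible to $F$ if this holds for some $f$. **Theorem.** The jump equivalence relation $J$ is eventually reducible to the infinite time degree relation $\equiv_\infty$; indeed it is so by the function $x\mapsto x^{\triangledown}$. In particular, $x\mapsto x^{\triangledown}$ is eventually computable. -/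

import Mathlib

namespace ITTM

/-- The reals, in the sense of the theory: Cantor space. -/
abbrev CantorReal : Type := ℕ → Bool

/-- The natural number `n` as an input real: the string of `n` ones followed by zeros. -/
def ofNat (n : ℕ) : CantorReal := fun k => decide (k < n)

/-- The real `0`, that is, the constantly zero sequence (an empty tape). -/
def zeroReal : CantorReal := fun _ => false

/-- The states of a program with `n` states besides the three distinguished ones. -/
abbrev State (n : ℕ) : Type := Fin (n + 3)

/-- The start state. -/
def State.start (n : ℕ) : State n := 0

/-- The limit state. -/
def State.limit (n : ℕ) : State n := 1

/-- The halt state. -/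
def State.halt (n : ℕ) : State n := 2

/-- What a machine does in one step: the bits it writes on the input, scratch and output tapes,
whether the head moves right (`true`) or left (`false`), and the next state. -/
abbrev Action (n : ℕ) : Type := (Bool × Bool × Bool) × Bool × State n

/-- A program: a finite set of states and a transition table which, for each state and each
combination of bits read on the oracle, input, scratch and output tapes (in this order),
prescribes an action. -/
abbrev Program : Type :=
  Σ n : ℕ, State n → Bool → Bool → Bool → Bool → Action n

/-- A function on the two bits is coded by the pair of its values. -/
instance encodableBoolArrow {α : Type} [Encodable α] : Encodable (Bool → α) :=
  Encodable.ofEquiv (α × α) (Equiv.boolArrowEquivProd α)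

/-- The standard effective Gödel numbering of programs, by coding the finite transition table
as a finite sequence with the usual pairing function. -/
def Program.index (p : Program) : ℕ := Encodable.encode p

/-- A configuration of a machine at a stage: the state, the position of the head on the
semi-infinite tapes (the single head reads the cells at this position on all tapes) and the
content of the input, scratch and output tapes. The oracle tape is read-only and is not part of
the configuration. -/
structure Config (n : ℕ) where
  state : State n
  head : ℕ
  input : CantorReal
  scratch : CantorReal
  output : CantorReal

/-- The starting configuration on input `x`. -/
def initialConfig (n : ℕ) (x : CantorReal) : Config n where
  state := State.start n
  head := 0
  input := x
  scratch := zeroReal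
  output := zeroReal

/-- One step of computation of program `p` with the real `z` on the oracle tape. A machine in the
halt state does nothing any more; a head at the leftmost cell told to move left stays there. -/
def step (p : Program) (z : CantorReal) (c : Config p.1) : Config p.1 :=
  if c.state = State.halt p.1 then c
  else
    let a : Action p.1 :=
      p.2 c.state (z c.head) (c.input c.head) (c.scratch c.head) (c.output c.head)
    { state := a.2.2
      head := if a.2.1 then c.head + 1 else c.head - 1
      input := Function.update c.input c.head a.1.1
      scratch := Function.update c.scratch c.head a.1.2.1
      output := Function.update c.output c.head a.1.2.2 }

open Classical in
/-- The content of a tape at the limit stage `l`, given its contents `t` at the earlier stages: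
every cell shows the `limsup` of its earlier values, so it shows `1` exactly if it showed `1`
at unboundedly many stages below `l`. -/
noncomputable def limsupTape (l : Ordinal.{0}) (t : ∀ a, a < l → CantorReal) : CantorReal :=
  fun k => decide (∀ a, a < l → ∃ (b : Ordinal.{0}) (hb : b < l), a ≤ b ∧ t b hb k = true)

open Classical in
/-- The configuration at the limit stage `l`, given the earlier ones: the machine enters the limit
state, the head returns to the leftmost cell and every cell is updated with the `limsup` of its
earlier values. A machine that has already halted remains in the halt state (and its tapes, being
eventually constant below `l`, are unchanged). -/
noncomputable def limitConfig {n : ℕ} (l : Ordinal.{0}) (c : ∀ a, a < l → Config n) :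
    Config n where
  state := if ∃ (a : Ordinal.{0}) (ha : a < l), (c a ha).state = State.halt n
    then State.halt n else State.limit n
  head := 0
  input := limsupTape l fun a ha => (c a ha).input
  scratch := limsupTape l fun a ha => (c a ha).scratch
  output := limsupTape l fun a ha => (c a ha).output

/-- The configuration at stage `a` of the computation of program `p` with oracle `z`
on input `x`. -/
noncomputable def run (p : Program) (z x : CantorReal) (a : Ordinal.{0}) : Config p.1 :=
  Ordinal.limitRecOn (motive := fun _ => Config p.1) a
    (initialConfig p.1 x)
    (fun _ c => step p z c)
    (fun l _ c => limitConfig l c)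

/-- `φ_p^z(x)↓`: program `p` with oracle `z` halts on input `x`. -/
def Halts (p : Program) (z x : CantorReal) : Prop :=
  ∃ a : Ordinal.{0}, (run p z x a).state = State.halt p.1

/-- `φ_p^z(x) = y`: program `p` with oracle `z` on input `x` halts with output `y`. -/
def Computes (p : Program) (z x y : CantorReal) : Prop :=
  ∃ a : Ordinal.{0}, (run p z x a).state = State.halt p.1 ∧ (run p z x a).output = y

/-- Program `p` with oracle `z` on input `x` eventually writes `y`: from some stage on the output
tape shows `y` (whether or not the computation halts). -/
def EventuallyWrites (p : Program) (z x y : CantorReal) : Prop :=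
  ∃ a : Ordinal.{0}, ∀ b : Ordinal.{0}, a ≤ b → (run p z x b).output = y

/-- `y ≤_∞ z`: the real `y` is infinite time computable from the real `z`. -/
def InfReducible (y z : CantorReal) : Prop :=
  ∃ p : Program, Computes p z zeroReal y

/-- The infinite time degree relation `y ≡_∞ z` on the reals. -/
def InfEquiv (y z : CantorReal) : Prop :=
  InfReducible y z ∧ InfReducible z y

open Classical in
/-- The lightface infinite time jump of the real `x`: the halting problem
`{p | φ_p^x(p)↓}` relative to `x`, as a set of indices of programs. -/
noncomputable def jump (x : CantorReal) : CantorReal :=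
  fun n => decide (∃ p : Program, p.index = n ∧ Halts p x (ofNat n))

/-- The jump equivalence relation: `x J y` if and only if the jumps of `x` and `y` have the same
infinite time degree. -/
def JumpEquiv (x y : CantorReal) : Prop :=
  InfEquiv (jump x) (jump y)

/-- `f` is eventually computable: some program, with a fixed real parameter on its oracle tape,
eventually writes `f x` on every input `x`. -/
def EventuallyComputable (f : CantorReal → CantorReal) : Prop :=
  ∃ (p : Program) (z : CantorReal), ∀ x : CantorReal, EventuallyWrites p z x (f x)

/-- `E` is eventually reducible to `F` by the function `f`. -/
def EventuallyReducibleBy (f : CantorReal → CantorReal)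
    (E F : CantorReal → CantorReal → Prop) : Prop :=
  EventuallyComputable f ∧ ∀ x y : CantorReal, E x y ↔ F (f x) (f y)

/-- `E ≤_e F`: `E` is eventually reducible to `F`. -/
def EventuallyReducible (E F : CantorReal → CantorReal → Prop) : Prop :=
  ∃ f : CantorReal → CantorReal, EventuallyReducibleBy f E F

end ITTM

namespace ITTM

/-! ### Basic facts about runs -/

/-! By definition $J$ is the pullback of $\equiv_\infty$ along the jump, so all the content is in
`eventuallyComputable_jump`. The idea is to simulate all programs $p$ on input $p$ with oracle $x$
simultaneously and to show a 1 in output cell $p$ once $p$ has halted. There are countably many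
programs, so all computations that halt have done so by some common stage. From then on the output
is $x^{\triangledown}$, and the machine need not recognise that stage.

No universal machine has to be programmed, since the real parameter is free. A fixed finite machine
(`streamTable`) executes an infinite list of symbols found on its oracle tape. For a sequence of
operations, each concerning finitely many bits of memory, the list contains their complete lookup
tables (`exists_oracle`). Each operation in `simSeq` performs at most one step of one program, and
every program is served infinitely often. The start and limit states both begin reading the list
anew. Hence a block of $\omega$ stages carries out $\omega$ steps of every program, and at stage
$\omega a$ the memory holds the configurations of all programs at stage $\omega a$
(`RepresentsAll`).

The difficulty is the passage to limits, where machine and simulated programs both take superior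
limits. A memory cell has to show the values of the cell it simulates up to a finite delay and,
apart from the very beginning, no others (`Tracks`); then the superior limits agree
(`Tracks.limsup`). For this reason an operation may only pass through memory contents in which every
bit has its old or its new value (`box`). The machine's own marks, and the coded states and head
positions of the programs, become meaningless at limits, but they are overwritten before they are
read. The state of a program at a limit is recovered from its halting bit and a bit telling whether
its simulation has begun. -/

theorem run_zero (p : Program) (z x : CantorReal) : run p z x 0 = initialConfig p.1 x := by
  simp [run]

theorem run_succ (p : Program) (z x : CantorReal) (a : Ordinal.{0}) :
    run p z x (Order.succ a) = step p z (run p z x a) := by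
  simp [run]

theorem run_limit (p : Program) (z x : CantorReal) {l : Ordinal.{0}} (hl : Order.IsSuccLimit l) :
    run p z x l = limitConfig l fun a _ => run p z x a := by
  simp [run, Ordinal.limitRecOn_limit _ _ _ _ hl]

theorem run_add_nat (p : Program) (z x : CantorReal) (a : Ordinal.{0}) (n : ℕ) :
    run p z x (a + n) = (step p z)^[n] (run p z x a) := by
  induction n with
  | zero => simp
  | succ n ih =>
    rw [Function.iterate_succ_apply', ← ih, ← run_succ, Nat.cast_succ, ← add_assoc,
      ← Order.succ_eq_add_one]

theorem limsupTape_eq_true {l : Ordinal.{0}} {t : ∀ a, a < l → CantorReal} {k : ℕ} :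
    limsupTape l t k = true ↔ ∀ a, a < l → ∃ b, ∃ hb : b < l, a ≤ b ∧ t b hb k = true := by
  simp [limsupTape]

/-! ### Programs given by a table on an arbitrary finite type of states -/

/-- A transition table on a type of states. -/
abbrev Table (Q : Type) : Type :=
  Q → Bool → Bool → Bool → Bool → (Bool × Bool × Bool) × Bool × Q

/-- A configuration of a machine whose states form the type `Q`. -/
@[ext] structure Snapshot (Q : Type) where
  state : Q
  head : ℕ
  input : CantorReal
  scratch : CantorReal
  output : CantorReal

section Table

variable {Q : Type}

/-- One step of computation according to a transition table. -/
def Table.step (δ : Table Q) (z : CantorReal) (c : Snapshot Q) : Snapshot Q :=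
  let a := δ c.state (z c.head) (c.input c.head) (c.scratch c.head) (c.output c.head)
  { state := a.2.2
    head := if a.2.1 then c.head + 1 else c.head - 1
    input := Function.update c.input c.head a.1.1
    scratch := Function.update c.scratch c.head a.1.2.1
    output := Function.update c.output c.head a.1.2.2 }

/-- The configuration of a program whose states are read as elements of `Q`. -/
def Config.snapshot {n : ℕ} (dec : State n → Q) (c : Config n) : Snapshot Q :=
  ⟨dec c.state, c.head, c.input, c.scratch, c.output⟩

/-- The program `p` acts according to the table `δ` when its states are read as elements of `Q`,
and does not enter the halt state. -/
def Table.ImplementedBy (δ : Table Q) (p : Program) (dec : State p.1 → Q) : Prop :=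
  ∀ s a b c d, (p.2 s a b c d).2.2 ≠ State.halt p.1 ∧
    ((p.2 s a b c d).1, (p.2 s a b c d).2.1, dec (p.2 s a b c d).2.2) = δ (dec s) a b c d

/-- Every table on a finite type of states is implemented by a program, which behaves in the start
state and in the limit state as the table prescribes for a given state. -/
theorem Table.exists_program [Finite Q] (δ : Table Q) (q₀ : Q) :
    ∃ (p : Program) (dec : State p.1 → Q), δ.ImplementedBy p dec ∧
      dec (State.start _) = q₀ ∧ dec (State.limit _) = q₀ := by
  obtain ⟨n, ⟨e⟩⟩ := Finite.exists_equiv_fin Q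
  -- The states of `Q` are shifted by 3 past the distinguished ones. Start and limit both decode to
  -- `q₀`, so the table restarts after each limit.
  let dec : State n → Q := fun s =>
    if h : 3 ≤ s.1 then e.symm ⟨s.1 - 3, by have := s.2; omega⟩ else q₀
  let enc : Q → State n := fun q => ⟨(e q).1 + 3, by have := (e q).2; omega⟩
  have hdec : ∀ q, dec (enc q) = q := by intro q; simp [dec, enc]
  refine ⟨⟨n, fun s a b c d => ((δ (dec s) a b c d).1, (δ (dec s) a b c d).2.1,
    enc (δ (dec s) a b c d).2.2)⟩, dec, ?_, ?_, ?_⟩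
  · intro s a b c d
    refine ⟨fun h => ?_, by simp [hdec]⟩
    have h := congrArg Fin.val h
    simp only [enc, State.halt, Fin.coe_ofNat_eq_mod] at h
    rw [Nat.mod_eq_of_lt (by omega)] at h
    omega
  · simp [dec, State.start]
  · simp [dec, State.limit]

theorem Table.ImplementedBy.step {δ : Table Q} {p : Program} {dec : State p.1 → Q}
    (h : δ.ImplementedBy p dec) (z : CantorReal) {c : Config p.1}
    (hc : c.state ≠ State.halt p.1) :
    (ITTM.step p z c).state ≠ State.halt p.1 ∧
      (ITTM.step p z c).snapshot dec = δ.step z (c.snapshot dec) := by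
  have := h c.state (z c.head) (c.input c.head) (c.scratch c.head) (c.output c.head)
  unfold ITTM.step
  rw [if_neg hc]
  refine ⟨this.1, ?_⟩
  simp [Config.snapshot, Table.step, ← this.2]

theorem Table.ImplementedBy.iterate {δ : Table Q} {p : Program} {dec : State p.1 → Q}
    (h : δ.ImplementedBy p dec) (z : CantorReal) {c : Config p.1}
    (hc : c.state ≠ State.halt p.1) (n : ℕ) :
    ((ITTM.step p z)^[n] c).state ≠ State.halt p.1 ∧
      ((ITTM.step p z)^[n] c).snapshot dec = (δ.step z)^[n] (c.snapshot dec) := by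
  induction n with
  | zero => exact ⟨hc, rfl⟩
  | succ n ih =>
    rw [Function.iterate_succ_apply', Function.iterate_succ_apply', ← ih.2]
    exact h.step z ih.1

end Table

/-! ### Machines on cells of width two -/

/-- A transition table for a machine which works on pairs of adjacent cells: it reads two bits of
the oracle, a mark and five bits of memory, and determines the next state, the direction of the
move (`true` for right), the new mark and the new bits of memory. -/
abbrev WideTable (S : Type) : Type :=
  S → Bool × Bool → Bool → (Fin 5 → Bool) → S × Bool × Bool × (Fin 5 → Bool)

/-- A configuration of a machine on pairs of adjacent cells. -/
structure WideConfig (S : Type) where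
  state : S
  pos : ℕ
  mark : ℕ → Bool
  mem : ℕ → Bool

/-- One step of computation of a machine on pairs of adjacent cells. -/
def WideTable.step {S : Type} (Δ : WideTable S) (ζ : ℕ → Bool × Bool) (c : WideConfig S) :
    WideConfig S :=
  let a := Δ c.state (ζ c.pos) (c.mark c.pos) (fun s => c.mem (5 * c.pos + s))
  { state := a.1
    pos := if a.2.1 then c.pos + 1 else c.pos - 1
    mark := Function.update c.mark c.pos a.2.2.1
    mem := fun i => if i / 5 = c.pos then a.2.2.2 ⟨i % 5, Nat.mod_lt _ (by norm_num)⟩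
      else c.mem i }

/-- The states of the machine on single cells which simulates a machine on pairs of cells. -/
inductive Phase (S : Type) : Type
  | read (q : S)
  | decide (q : S) (z i s o : Bool)
  | write (q : S) (d i s o : Bool)
  | move (q : S) (d : Bool)
  deriving Fintype

/-- The transition table simulating a machine on pairs of cells by a machine on single cells. -/
def WideTable.table {S : Type} (Δ : WideTable S) : Table (Phase S)
  | .read q, z, i, s, o => ((i, s, o), true, .decide q z i s o)
  | .decide q z i s o, z', i', s', o' =>
    let a := Δ q (z, z') s ![i, i', o, o', s']
    ((a.2.2.2 1, a.2.2.2 4, a.2.2.2 3), false,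
      .write a.1 a.2.1 (a.2.2.2 0) a.2.2.1 (a.2.2.2 2))
  | .write q d i s o, _, _, _, _ => ((i, s, o), d, .move q d)
  | .move q d, _, i, s, o => ((i, s, o), d, .read q)

/-- The oracle tape with the given pairs of bits. -/
def pairTape (ζ : ℕ → Bool × Bool) : CantorReal :=
  fun k => if k % 2 = 0 then (ζ (k / 2)).1 else (ζ (k / 2)).2

/-- The position in memory of a cell of the input tape. -/
def inputCell (k : ℕ) : ℕ := 5 * (k / 2) + k % 2

/-- The position in memory of a cell of the output tape. -/
def outputCell (k : ℕ) : ℕ := 5 * (k / 2) + 2 + k % 2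

/-- The position in memory of a cell with odd position on the scratch tape. -/
def workCell (k : ℕ) : ℕ := 5 * k + 4

/-- The content of the memory, read off the tapes. -/
def Snapshot.mem {Q : Type} (c : Snapshot Q) (i : ℕ) : Bool :=
  if i % 5 = 0 then c.input (2 * (i / 5))
  else if i % 5 = 1 then c.input (2 * (i / 5) + 1)
  else if i % 5 = 2 then c.output (2 * (i / 5))
  else if i % 5 = 3 then c.output (2 * (i / 5) + 1)
  else c.scratch (2 * (i / 5) + 1)

/-- The marks, read off the tapes. -/
def Snapshot.mark {Q : Type} (c : Snapshot Q) (k : ℕ) : Bool := c.scratch (2 * k)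

/-- The configuration of the simulating machine. -/
def WideConfig.snapshot {S : Type} (c : WideConfig S) : Snapshot (Phase S) where
  state := .read c.state
  head := 2 * c.pos
  input k := c.mem (inputCell k)
  scratch k := if k % 2 = 0 then c.mark (k / 2) else c.mem (workCell (k / 2))
  output k := c.mem (outputCell k)

theorem WideConfig.mem_snapshot {S : Type} (c : WideConfig S) : c.snapshot.mem = c.mem := by
  funext i
  simp only [Snapshot.mem, WideConfig.snapshot, inputCell, outputCell, workCell]
  split_ifs <;> first | omega | (congr 1; omega)

/-- The marks and the memory together exhaust the three writable tapes. So whatever a limit leaves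
on the tapes can be read as a configuration of the wide machine. -/
theorem Snapshot.eq_snapshot {S : Type} (c : Snapshot (Phase S)) (q : S) (k : ℕ)
    (hq : c.state = .read q) (hk : c.head = 2 * k) :
    c = (WideConfig.mk q k c.mark c.mem).snapshot := by
  ext j
  · simp [WideConfig.snapshot, hq]
  · simp [WideConfig.snapshot, hk]
  · rcases Nat.mod_two_eq_zero_or_one j with h | h <;>
    · simp only [WideConfig.snapshot, Snapshot.mem, inputCell, h]
      split_ifs <;> first | omega | (congr 1; omega)
  · rcases Nat.mod_two_eq_zero_or_one j with h | h
    · simp only [WideConfig.snapshot, Snapshot.mark, h, if_true]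
      congr 1; omega
    · simp only [WideConfig.snapshot, Snapshot.mem, workCell, h, one_ne_zero, if_false]
      have h4 : (5 * (j / 2) + 4) % 5 = 4 := by omega
      have h5 : 2 * ((5 * (j / 2) + 4) / 5) + 1 = j := by omega
      simp [h4, h5]
  · rcases Nat.mod_two_eq_zero_or_one j with h | h <;>
    · simp only [WideConfig.snapshot, Snapshot.mem, outputCell, h]
      split_ifs <;> first | omega | (congr 1; omega)

/-- One wide step takes four steps: read the even cell, write the odd cell, write the even cell, and
complete the move by a second step in the same direction. The second claim ensures that no spurious
bit appears in between, which matters for superior limits. -/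
theorem WideTable.iterate_snapshot {S : Type} (Δ : WideTable S) (ζ : ℕ → Bool × Bool)
    (c : WideConfig S) :
    (Δ.table.step (pairTape ζ))^[4] c.snapshot = (Δ.step ζ c).snapshot ∧
      ∀ n ≤ 4, ∀ i, ((Δ.table.step (pairTape ζ))^[n] c.snapshot).mem i = c.mem i ∨
        ((Δ.table.step (pairTape ζ))^[n] c.snapshot).mem i = (Δ.step ζ c).mem i := by
  obtain ⟨q, k, mark, mem⟩ := c
  set T := Δ.table.step (pairTape ζ) with hT
  have hz0 : pairTape ζ (2 * k) = (ζ k).1 := by simp [pairTape]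
  have hz1 : pairTape ζ (2 * k + 1) = (ζ k).2 := by
    have h1 : (2 * k + 1) % 2 = 1 := by omega
    have h2 : (2 * k + 1) / 2 = k := by omega
    simp [pairTape, h1, h2]
  set c₀ := (WideConfig.mk q k mark mem).snapshot with hc₀
  set a := Δ q (ζ k) (mark k) (fun s => mem (5 * k + s)) with ha
  have e1 : T c₀ = ⟨.decide q (ζ k).1 (mem (5 * k)) (mark k) (mem (5 * k + 2)), 2 * k + 1,
      c₀.input, c₀.scratch, c₀.output⟩ := by
    simp only [hT, Table.step, hc₀, WideConfig.snapshot, WideTable.table, hz0]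
    ext j <;> simp [inputCell, outputCell, Function.update_apply]
    · rintro rfl; simp
    · rintro rfl; simp
    · rintro rfl; simp
  have e2 : T (T c₀) = ⟨.write a.1 a.2.1 (a.2.2.2 0) a.2.2.1 (a.2.2.2 2), 2 * k,
      Function.update c₀.input (2 * k + 1) (a.2.2.2 1),
      Function.update c₀.scratch (2 * k + 1) (a.2.2.2 4),
      Function.update c₀.output (2 * k + 1) (a.2.2.2 3)⟩ := by
    have h1 : (2 * k + 1) % 2 = 1 := by omega
    have h2 : (2 * k + 1) / 2 = k := by omega
    have hm : ![mem (5 * k), mem (5 * k + 1), mem (5 * k + 2), mem (5 * k + 3),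
        mem (5 * k + 4)] = fun s : Fin 5 => mem (5 * k + s) := by
      funext s; fin_cases s <;> rfl
    rw [e1]
    simp only [hT, Table.step, hc₀, WideConfig.snapshot, WideTable.table, hz1, inputCell,
      outputCell, workCell, h1, h2, one_ne_zero, if_false]
    simp [hm, ← ha]
  have e3' : T (T (T c₀)) = ⟨.move a.1 a.2.1, if a.2.1 then 2 * k + 1 else 2 * k - 1,
      Function.update (Function.update c₀.input (2 * k + 1) (a.2.2.2 1)) (2 * k) (a.2.2.2 0),
      Function.update (Function.update c₀.scratch (2 * k + 1) (a.2.2.2 4)) (2 * k) a.2.2.1,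
      Function.update (Function.update c₀.output (2 * k + 1) (a.2.2.2 3)) (2 * k)
        (a.2.2.2 2)⟩ := by
    rw [e2]
    rfl
  have e3 : T (T (T c₀)) = ⟨.move a.1 a.2.1, if a.2.1 then 2 * k + 1 else 2 * k - 1,
      (Δ.step ζ ⟨q, k, mark, mem⟩).snapshot.input, (Δ.step ζ ⟨q, k, mark, mem⟩).snapshot.scratch,
      (Δ.step ζ ⟨q, k, mark, mem⟩).snapshot.output⟩ := by
    rw [e3', Snapshot.mk.injEq]
    have hd : ∀ j : ℕ, j = 2 * (j / 2) ∨ j = 2 * (j / 2) + 1 := by intro j; omega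
    have h1 : ∀ j : ℕ, (2 * j + 1) % 2 = 1 := by intro j; omega
    have h2 : ∀ j : ℕ, (2 * j + 1) / 2 = j := by intro j; omega
    have h3 : ∀ j : ℕ, (5 * j + 1) / 5 = j ∧ (5 * j + 2) / 5 = j ∧ (5 * j + 3) / 5 = j ∧
      (5 * j + 4) / 5 = j := by intro j; omega
    have h4 : ∀ j : ℕ, (5 * j + 1) % 5 = 1 ∧ (5 * j + 2) % 5 = 2 ∧ (5 * j + 3) % 5 = 3 ∧
      (5 * j + 4) % 5 = 4 := by intro j; omega
    have h5 : ∀ i j : ℕ, 2 * i ≠ 2 * j + 1 ∧ 2 * i + 1 ≠ 2 * j := by intro i j; omega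
    refine ⟨rfl, rfl, ?_, ?_, ?_⟩ <;> funext j <;> obtain ⟨l, hl | hl⟩ : ∃ l, j = 2 * l ∨
      j = 2 * l + 1 := ⟨_, hd j⟩ <;> subst hl <;> by_cases hk : l = k <;>
      simp [hc₀, WideConfig.snapshot, WideTable.step, ← ha, Function.update_apply, inputCell,
        outputCell, workCell, h1, h2, h3, h4, h5, hk]
  have e4 : T (T (T (T c₀))) = (Δ.step ζ ⟨q, k, mark, mem⟩).snapshot := by
    rw [e3]
    simp only [hT, Table.step, WideTable.table, Function.update_eq_self]
    ext j <;> simp [WideTable.step, WideConfig.snapshot, ← ha]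
    split_ifs <;> omega
  refine ⟨e4, fun n hn i => ?_⟩
  have hm3 : (T (T (T c₀))).mem i = (Δ.step ζ ⟨q, k, mark, mem⟩).mem i := by
    rw [← WideConfig.mem_snapshot (Δ.step ζ ⟨q, k, mark, mem⟩), e3]; rfl
  have hm0 : c₀.mem = mem := WideConfig.mem_snapshot _
  interval_cases n
  · left; exact congrFun hm0 i
  · left
    show (T c₀).mem i = mem i
    rw [e1, ← hm0]; rfl
  -- Here the write is half done: the odd cells carry the new bits, the even cells still the old
  -- ones.
  · show (T (T c₀)).mem i = mem i ∨ (T (T c₀)).mem i = _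
    rw [← hm3, ← hm0, e3', e2]
    have h5 : ∀ i j : ℕ, 2 * i ≠ 2 * j + 1 ∧ 2 * i + 1 ≠ 2 * j := by intro i j; omega
    simp only [Snapshot.mem]
    split_ifs
    · left; exact Function.update_of_ne (h5 _ _).1 _ _
    · right; exact (Function.update_of_ne (h5 _ _).2 _ _).symm
    · left; exact Function.update_of_ne (h5 _ _).1 _ _
    · right; exact (Function.update_of_ne (h5 _ _).2 _ _).symm
    · right; exact (Function.update_of_ne (h5 _ _).2 _ _).symm
  · right; exact hm3
  · right
    show (T (T (T (T c₀)))).mem i = _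
    rw [e4, WideConfig.mem_snapshot]

/-! ### Computation paths along which the memory stays in a given set -/

/-- `n` steps of `T` lead from `c` to `c'`, and `f` takes values in `S` along the way. -/
def Path {X M : Type} (T : X → X) (f : X → M) (S : Set M) (n : ℕ) (c c' : X) : Prop :=
  T^[n] c = c' ∧ ∀ i ≤ n, f (T^[i] c) ∈ S

theorem Path.refl {X M : Type} {T : X → X} {f : X → M} {S : Set M} {c : X} (h : f c ∈ S) :
    Path T f S 0 c c :=
  ⟨rfl, fun i hi => by rwa [Nat.le_zero.1 hi]⟩

theorem Path.trans {X M : Type} {T : X → X} {f : X → M} {S : Set M} {m n : ℕ} {c c' c'' : X}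
    (h : Path T f S m c c') (h' : Path T f S n c' c'') : Path T f S (m + n) c c'' := by
  refine ⟨?_, fun i hi => ?_⟩
  · rw [add_comm, Function.iterate_add_apply, h.1, h'.1]
  · rcases le_total i m with him | him
    · exact h.2 i him
    · obtain ⟨j, rfl⟩ := Nat.exists_eq_add_of_le him
      rw [add_comm, Function.iterate_add_apply, h.1]
      exact h'.2 j (by omega)

theorem Path.single {X M : Type} {T : X → X} {f : X → M} {S : Set M} {c c' : X} (h : T c = c')
    (hc : f c ∈ S) (hc' : f c' ∈ S) : Path T f S 1 c c' := by
  refine ⟨h, fun i hi => ?_⟩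
  interval_cases i
  · exact hc
  · change f (T c) ∈ S
    rwa [h]

/-- The set of memory contents every bit of which agrees with one of two given ones. -/
def box (m m' : ℕ → Bool) : Set (ℕ → Bool) := {u | ∀ i, u i = m i ∨ u i = m' i}

theorem left_mem_box (m m' : ℕ → Bool) : m ∈ box m m' := fun _ => Or.inl rfl

theorem right_mem_box (m m' : ℕ → Bool) : m' ∈ box m m' := fun _ => Or.inr rfl

/-- A box is closed under bitwise mixing, so the four-step refinement of a wide step does not leave
it. -/
theorem mem_box_of_box {m m' u u' v : ℕ → Bool} (hu : u ∈ box m m') (hu' : u' ∈ box m m')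
    (hv : ∀ i, v i = u i ∨ v i = u' i) : v ∈ box m m' := by
  intro i
  rcases hv i with h | h <;> rw [h]
  exacts [hu i, hu' i]

/-- A path of a machine on pairs of cells gives one of the simulating machine. -/
theorem WideTable.path_snapshot {S : Type} {Δ : WideTable S} {ζ : ℕ → Bool × Bool}
    {m m' : ℕ → Bool} {n : ℕ} {c c' : WideConfig S}
    (h : Path (Δ.step ζ) WideConfig.mem (box m m') n c c') :
    Path (Δ.table.step (pairTape ζ)) Snapshot.mem (box m m') (4 * n) c.snapshot c'.snapshot := by
  induction n generalizing c with
  | zero =>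
    obtain rfl : c = c' := h.1
    exact Path.refl (by rw [WideConfig.mem_snapshot]; exact h.2 0 le_rfl)
  | succ n ih =>
    have h0 := h.2 0 (Nat.zero_le _)
    have h1 := h.2 1 (by omega)
    have := Δ.iterate_snapshot ζ c
    have h' : Path (Δ.table.step (pairTape ζ)) Snapshot.mem (box m m') 4 c.snapshot
        (Δ.step ζ c).snapshot :=
      ⟨this.1, fun i hi => mem_box_of_box h0 h1 (this.2 i hi)⟩
    rw [show 4 * (n + 1) = 4 + 4 * n by ring]
    exact h'.trans (ih ⟨h.1, fun i hi => h.2 (i + 1) (by omega)⟩)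

/-! ### A machine which executes a stream of symbols -/

/-- The flags of the stream machine: whether it is writing (or else comparing), whether the
comparison has succeeded so far, and whether some comparison of the present group has succeeded. -/
structure Flags : Type where
  writing : Bool
  hit : Bool
  done : Bool
  deriving Fintype

/-- The flags after a symbol is executed, where `b` is the bit of memory at the pointer. The symbols
`(false, _)` stand for bits, and `(true, false)` toggles between comparing and writing, and
`(true, true)` ends a group. -/
def Flags.next : Flags → Bool × Bool → Bool → Flags
  | ⟨false, hit, done⟩, (false, a), b => ⟨false, hit && (a == b), done⟩
  | ⟨true, hit, done⟩, (false, _), _ => ⟨true, hit, done⟩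
  -- A match counts only if no earlier clause of the group was applied, because the memory already
  -- changed may happen to fit a later pattern.
  | ⟨false, hit, done⟩, (true, false), _ => ⟨true, hit && !done, hit || done⟩
  | ⟨true, _, done⟩, (true, false), _ => ⟨false, true, done⟩
  | ⟨writing, hit, _⟩, (true, true), _ => ⟨writing, hit, false⟩

/-- The move of the pointer when a symbol is executed, `true` for right. -/
def Flags.shift : Flags → Bool × Bool → Option Bool
  | ⟨false, _, _⟩, (false, _) => some true
  | ⟨true, _, _⟩, (false, _) => some false
  | ⟨false, _, _⟩, (true, false) => some false
  | ⟨true, _, _⟩, (true, false) => none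
  | _, (true, true) => none

/-- The new bit of memory at the pointer when a symbol is executed. -/
def Flags.bit : Flags → Bool × Bool → Bool → Bool
  | ⟨true, true, _⟩, (false, a), _ => a
  | _, _, b => b

/-- The flags, the pointer and the memory of the stream machine. -/
@[ext] structure Tally : Type where
  flags : Flags
  ptr : ℕ
  mem : ℕ → Bool

/-- The effect of executing one symbol. -/
def Tally.step (t : Tally) (s : Bool × Bool) : Tally where
  flags := t.flags.next s (t.mem t.ptr)
  ptr := match t.flags.shift s with
    | none => t.ptr
    | some true => t.ptr + 1
    | some false => t.ptr - 1
  mem := Function.update t.mem t.ptr (t.flags.bit s (t.mem t.ptr))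

/-- The states of the machine on pairs of cells which executes a stream of symbols. -/
inductive Control : Type
  | init
  | fetch (f : Flags) (sub : Fin 5)
  | seek (s : Bool × Bool) (f : Flags) (sub : Fin 5)
  | put (f : Flags) (sub : Fin 5)
  | back (f : Flags) (sub : Fin 5)
  deriving Fintype

/-- The machine which executes the stream of symbols on its oracle tape. One mark is at the pointer
into the memory and another mark, to the right of the first one, is at the present symbol. For each
symbol, the machine walks from the second mark to the first one and back. -/
def streamTable : WideTable Control
  -- The first cell carries no symbol; it receives the pointer mark, so that the symbol mark always
  -- lies to the right of it.
  | .init, _, _, m => (.fetch ⟨false, true, false⟩ 0, true, true, m)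
  | .fetch f sub, s, _, m => (.seek s f sub, false, true, m)
  | .seek s f sub, _, false, m => (.seek s f sub, false, false, m)
  | .seek s f sub, _, true, m =>
    let m' := Function.update m sub (f.bit s (m sub))
    let f' := f.next s (m sub)
    match f.shift s with
    | none => (.back f' sub, true, true, m')
    | some true =>
      if sub = 4 then (.put f' 0, true, false, m') else (.back f' (sub + 1), true, true, m')
    | some false =>
      if sub = 0 then (.put f' 4, false, false, m') else (.back f' (sub - 1), true, true, m')
  | .put f sub, _, _, m => (.back f sub, true, true, m)
  | .back f sub, _, false, m => (.back f sub, true, false, m)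
  | .back f sub, _, true, m => (.fetch f sub, true, false, m)

/-- The remainder of a position modulo `5`. -/
def sub5 (i : ℕ) : Fin 5 := ⟨i % 5, Nat.mod_lt _ (by norm_num)⟩

/-- The stream machine is about to execute the symbol at position `l`. -/
structure Ready (c : WideConfig Control) (l : ℕ) (t : Tally) : Prop where
  state : c.state = .fetch t.flags (sub5 t.ptr)
  pos : c.pos = l
  mem : c.mem = t.mem
  -- Nothing is claimed from `l` on, where marks may be left over from before a limit; `fetch`
  -- overwrites them one by one.
  mark : ∀ j < l, c.mark j = decide (j = t.ptr / 5)

theorem wideMem_eq_self (m : ℕ → Bool) (k : ℕ) :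
    (fun i => if i / 5 = k then m (5 * k + i % 5) else m i) = m := by
  funext i
  split_ifs with h
  · congr 1; omega
  · rfl

section Stream

variable {ζ : ℕ → Bool × Bool} {S : Set (ℕ → Bool)}

theorem path_seek {mark m : ℕ → Bool} (hm : m ∈ S) (s : Bool × Bool) (f : Flags) (sub : Fin 5)
    (k d : ℕ) (h : ∀ j, k < j → j ≤ k + d → mark j = false) :
    Path (streamTable.step ζ) WideConfig.mem S d ⟨.seek s f sub, k + d, mark, m⟩
      ⟨.seek s f sub, k, mark, m⟩ := by
  induction d with
  | zero => exact Path.refl hm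
  | succ d ih =>
    have h1 := h (k + (d + 1)) (by omega) le_rfl
    rw [add_comm d 1]
    refine (Path.single ?_ hm hm).trans (ih fun j hj hj' => h j hj (by omega))
    rw [add_comm 1 d]
    simp only [WideTable.step, h1, streamTable, wideMem_eq_self]
    rw [Function.update_eq_self_iff.2 h1.symm]
    rfl

theorem path_back {mark m : ℕ → Bool} (hm : m ∈ S) (f : Flags) (sub : Fin 5)
    (k d : ℕ) (h : ∀ j, k ≤ j → j < k + d → mark j = false) :
    Path (streamTable.step ζ) WideConfig.mem S d ⟨.back f sub, k, mark, m⟩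
      ⟨.back f sub, k + d, mark, m⟩ := by
  induction d with
  | zero => exact Path.refl hm
  | succ d ih =>
    have h1 := h (k + d) (by omega) (by omega)
    refine (ih fun j hj hj' => h j hj (by omega)).trans (Path.single ?_ hm hm)
    simp only [WideTable.step, h1, streamTable, wideMem_eq_self]
    rw [Function.update_eq_self_iff.2 h1.symm]
    rfl

theorem path_return {mark m : ℕ → Bool} (hm : m ∈ S) (f : Flags) (i j l : ℕ)
    (hj : i / 5 < j) (hjl : j ≤ l) (hmark : ∀ r < l, mark r = decide (r = i / 5))
    (hl : mark l = true) :
    ∃ n c', Path (streamTable.step ζ) WideConfig.mem S n ⟨.back f (sub5 i), j, mark, m⟩ c' ∧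
      Ready c' (l + 1) ⟨f, i, m⟩ := by
  obtain ⟨d, rfl⟩ := Nat.exists_eq_add_of_le hjl
  refine ⟨d + 1, ⟨.fetch f (sub5 i), j + d + 1, Function.update mark (j + d) false, m⟩,
    (path_back hm f _ j d fun r hr hr' => ?_).trans (Path.single ?_ hm hm), rfl, rfl, rfl,
    fun r hr => ?_⟩
  · rw [hmark r hr']; simp; omega
  · simp only [WideTable.step, hl, streamTable, wideMem_eq_self]
    rfl
  · rcases Nat.lt_succ_iff_lt_or_eq.1 hr with hr | rfl
    · exact (Function.update_of_ne hr.ne _ _).trans (hmark r hr)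
    · have : j + d ≠ i / 5 := by omega
      simp [this]

theorem wideMem_update (m : ℕ → Bool) (i : ℕ) (b : Bool) :
    (fun r => if r / 5 = i / 5 then
      Function.update (fun s : Fin 5 => m (5 * (i / 5) + s)) (sub5 i) b
        ⟨r % 5, Nat.mod_lt _ (by norm_num)⟩ else m r) = Function.update m i b := by
  funext r
  by_cases h : r = i
  · subst h; simp [sub5]
  · rw [Function.update_of_ne h]
    split_ifs with h'
    · rw [Function.update_of_ne (by simp [sub5]; omega)]
      congr 1
      simp; omega
    · rfl

/-- The stream machine executes a symbol. -/
theorem Ready.exists_path {c : WideConfig Control} {l : ℕ} {t : Tally} (h : Ready c l t)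
    (hl : t.ptr < l) (hs : t.flags.shift (ζ l) = some false → 0 < t.ptr) (hm : t.mem ∈ S)
    (hm' : (t.step (ζ l)).mem ∈ S) :
    ∃ n > 0, ∃ c', Path (streamTable.step ζ) WideConfig.mem S n c c' ∧
      Ready c' (l + 1) (t.step (ζ l)) := by
  obtain ⟨st, pos, mark, mem⟩ := c
  obtain ⟨f, i, m⟩ := t
  obtain ⟨h1, h2, h3, h4⟩ := h
  simp only at h1 h2 h3 h4 hl hs hm
  subst h1 h2 h3
  set s := ζ pos with hsdef
  have hk : i / 5 < pos := by omega
  obtain ⟨d, rfl⟩ : ∃ d, pos = i / 5 + d + 1 := ⟨pos - 1 - i / 5, by omega⟩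
  set l := i / 5 + d + 1 with hldef
  set mark₁ := Function.update mark l true with hmark₁
  have hm1 : ∀ j < l, mark₁ j = decide (j = i / 5) := fun j hj => by
    rw [hmark₁, Function.update_of_ne hj.ne]; exact h4 j hj
  have hm1l : mark₁ l = true := by simp [hmark₁]
  have p1 : Path (streamTable.step ζ) WideConfig.mem S 1 ⟨.fetch f (sub5 i), l, mark, mem⟩
      ⟨.seek s f (sub5 i), i / 5 + d, mark₁, mem⟩ := by
    refine Path.single ?_ hm hm
    simp only [WideTable.step, streamTable, wideMem_eq_self]
    rfl
  have p2 : Path (streamTable.step ζ) WideConfig.mem S d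
      ⟨.seek s f (sub5 i), i / 5 + d, mark₁, mem⟩ ⟨.seek s f (sub5 i), i / 5, mark₁, mem⟩ :=
    path_seek hm _ _ _ _ _ fun j hj hj' => by
      rw [hm1 j (by omega), decide_eq_false (by omega)]
  have hmk : mark₁ (i / 5) = true := by rw [hm1 _ hk]; simp
  have hmi : mem (5 * (i / 5) + (sub5 i : ℕ)) = mem i := by
    congr 1; simp only [sub5]; omega
  set m' := Function.update mem i (f.bit s (mem i)) with hm'def
  have hm'S : m' ∈ S := hm'
  suffices ∃ n c', Path (streamTable.step ζ) WideConfig.mem S n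
      ⟨.seek s f (sub5 i), i / 5, mark₁, mem⟩ c' ∧ Ready c' (l + 1)
        (Tally.step ⟨f, i, mem⟩ s) by
    obtain ⟨n, c', hp, hr⟩ := this
    exact ⟨_, by omega, c', (p1.trans p2).trans hp, hr⟩
  -- The pointer remains within its wide cell, so the mark stays where it is.
  have stay : ∀ i', i' / 5 = i / 5 →
      streamTable.step ζ ⟨.seek s f (sub5 i), i / 5, mark₁, mem⟩ =
        ⟨.back (f.next s (mem i)) (sub5 i'), i / 5 + 1, mark₁, m'⟩ →
      ∃ n c', Path (streamTable.step ζ) WideConfig.mem S n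
        ⟨.seek s f (sub5 i), i / 5, mark₁, mem⟩ c' ∧ Ready c' (l + 1)
          ⟨f.next s (mem i), i', m'⟩ := by
    intro i' hi' hstep
    obtain ⟨n, c', hp, hr⟩ := path_return (ζ := ζ) hm'S (f.next s (mem i)) i' (i / 5 + 1) l
      (by omega) (by omega) (by rw [hi']; exact hm1) hm1l
    exact ⟨_, c', (Path.single hstep hm hm'S).trans hp, hr⟩
  -- The pointer crosses into a neighbouring wide cell: the old mark is erased and `put` sets the
  -- new one.
  have far : ∀ i', i' / 5 ≠ i / 5 → i' / 5 < l →
      streamTable.step ζ ⟨.seek s f (sub5 i), i / 5, mark₁, mem⟩ =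
        ⟨.put (f.next s (mem i)) (sub5 i'), i' / 5, Function.update mark₁ (i / 5) false, m'⟩ →
      ∃ n c', Path (streamTable.step ζ) WideConfig.mem S n
        ⟨.seek s f (sub5 i), i / 5, mark₁, mem⟩ c' ∧ Ready c' (l + 1)
          ⟨f.next s (mem i), i', m'⟩ := by
    intro i' hi' hil hstep
    obtain ⟨n, c', hp, hr⟩ := path_return (ζ := ζ) (S := S)
      (mark := Function.update (Function.update mark₁ (i / 5) false) (i' / 5) true) hm'S
      (f.next s (mem i)) i' (i' / 5 + 1) l (by omega) (by omega)
      (fun r hr => by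
        by_cases h1 : r = i' / 5
        · subst h1; simp
        · rw [Function.update_of_ne h1]
          by_cases h2 : r = i / 5
          · subst h2; simp [hi'.symm]
          · rw [Function.update_of_ne h2, hm1 r hr]; simp [h1, h2])
      (by rw [Function.update_of_ne (by omega), Function.update_of_ne (by omega)]; exact hm1l)
    have hput : streamTable.step ζ ⟨.put (f.next s (mem i)) (sub5 i'), i' / 5,
        Function.update mark₁ (i / 5) false, m'⟩ = ⟨.back (f.next s (mem i)) (sub5 i'),
          i' / 5 + 1, Function.update (Function.update mark₁ (i / 5) false) (i' / 5) true, m'⟩ := by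
      simp only [WideTable.step, streamTable, wideMem_eq_self]
      rfl
    exact ⟨_, c', ((Path.single hstep hm hm'S).trans (Path.single hput hm'S hm'S)).trans hp, hr⟩
  have hupd : Function.update mark₁ (i / 5) true = mark₁ :=
    Function.update_eq_self_iff.2 hmk.symm
  have key : ∀ x : Control × Bool × Bool, ∀ p,
      streamTable (.seek s f (sub5 i)) (ζ (i / 5)) true
        (fun s => mem (5 * (i / 5) + s)) = (x.1, x.2.1, x.2.2, Function.update
          (fun s : Fin 5 => mem (5 * (i / 5) + s)) (sub5 i) (f.bit s (mem i))) →
      p = (if x.2.1 then i / 5 + 1 else i / 5 - 1) →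
      streamTable.step ζ ⟨.seek s f (sub5 i), i / 5, mark₁, mem⟩ =
        ⟨x.1, p, Function.update mark₁ (i / 5) x.2.2, m'⟩ := by
    rintro ⟨x1, x2, x3⟩ p hx hp
    simp only [WideTable.step, hmk, hx, wideMem_update, hp, hm'def]
  clear_value s
  cases hsh : f.shift s with
  | none =>
    rw [show Tally.step ⟨f, i, mem⟩ s = ⟨f.next s (mem i), i, m'⟩ by simp [Tally.step, hsh, m']]
    refine stay i rfl ?_
    rw [key (.back (f.next s (mem i)) (sub5 i), true, true) (i / 5 + 1)
      (by simp [streamTable, hsh, hmi]) rfl, hupd]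
  | some d =>
    cases d with
    | true =>
      rw [show Tally.step ⟨f, i, mem⟩ s = ⟨f.next s (mem i), i + 1, m'⟩ by
        simp [Tally.step, hsh, m']]
      by_cases h4 : i % 5 = 4
      · have e1 : sub5 i = 4 := Fin.ext h4
        have e2 : sub5 (i + 1) = 0 := Fin.ext (by simp [sub5]; omega)
        refine far (i + 1) (by omega) (by omega) ?_
        rw [key (.put (f.next s (mem i)) 0, true, false) ((i + 1) / 5)
          (by simp only [streamTable, hsh, hmi]; simp [e1]) (by simp; omega), e2]
      · have e1 : sub5 i ≠ 4 := fun h => h4 (congrArg Fin.val h)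
        have e2 : sub5 (i + 1) = sub5 i + 1 := Fin.ext (by simp [sub5, Fin.val_add])
        refine stay (i + 1) (by omega) ?_
        rw [key (.back (f.next s (mem i)) (sub5 i + 1), true, true) (i / 5 + 1)
          (by simp only [streamTable, hsh, hmi]; simp [e1]) rfl, hupd, e2]
    | false =>
      have hi := hs hsh
      rw [show Tally.step ⟨f, i, mem⟩ s = ⟨f.next s (mem i), i - 1, m'⟩ by
        simp [Tally.step, hsh, m']]
      by_cases h0 : i % 5 = 0
      · have e1 : sub5 i = 0 := Fin.ext h0
        have e2 : sub5 (i - 1) = 4 := Fin.ext (by simp [sub5]; omega)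
        refine far (i - 1) (by omega) (by omega) ?_
        rw [key (.put (f.next s (mem i)) 4, false, false) ((i - 1) / 5)
          (by simp only [streamTable, hsh, hmi]; simp [e1]) (by simp; omega), e2]
      · have e1 : sub5 i ≠ 0 := fun h => h0 (congrArg Fin.val h)
        have e2 : sub5 (i - 1) = sub5 i - 1 := by
          rw [eq_sub_iff_add_eq]
          exact Fin.ext (by simp [sub5, Fin.val_add]; omega)
        refine stay (i - 1) (by omega) ?_
        rw [key (.back (f.next s (mem i)) (sub5 i - 1), true, true) (i / 5 + 1)
          (by simp only [streamTable, hsh, hmi]; simp [e1]) rfl, hupd, e2]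

end Stream

/-! ### Programming the stream machine -/

/-- Executing a list of symbols leads from `t` to `t'` with the memory in `S` all the time. -/
def Tally.Runs (S : Set (ℕ → Bool)) : List (Bool × Bool) → Tally → Tally → Prop
  | [], t, t' => t = t' ∧ t.mem ∈ S
  | s :: L, t, t' => (t.flags.shift s = some false → 0 < t.ptr) ∧ t.mem ∈ S ∧
      Tally.Runs S L (t.step s) t'

theorem Tally.Runs.append {S : Set (ℕ → Bool)} {L L' : List (Bool × Bool)} {t t' t'' : Tally}
    (h : Tally.Runs S L t t') (h' : Tally.Runs S L' t' t'') : Tally.Runs S (L ++ L') t t'' := by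
  induction L generalizing t with
  | nil => obtain ⟨rfl, -⟩ := h; exact h'
  | cons s L ih => exact ⟨h.1, h.2.1, ih h.2.2⟩

theorem Tally.Runs.mem_left {S : Set (ℕ → Bool)} {L : List (Bool × Bool)} {t t' : Tally}
    (h : Tally.Runs S L t t') : t.mem ∈ S := by
  cases L with
  | nil => exact h.2
  | cons s L => exact h.2.1

theorem Tally.ptr_step_le (t : Tally) (s : Bool × Bool) : (t.step s).ptr ≤ t.ptr + 1 := by
  simp only [Tally.step]
  split <;> omega

/-- The stream machine executes a list of symbols which it finds on its oracle tape. -/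
theorem Tally.Runs.exists_path {ζ : ℕ → Bool × Bool} {S : Set (ℕ → Bool)}
    {L : List (Bool × Bool)} {t t' : Tally} (h : Tally.Runs S L t t') {c : WideConfig Control}
    {l : ℕ} (hc : Ready c l t) (hl : t.ptr < l) (hL : ∀ i (hi : i < L.length), ζ (l + i) = L[i]) :
    ∃ n ≥ L.length, ∃ c', Path (streamTable.step ζ) WideConfig.mem S n c c' ∧
      Ready c' (l + L.length) t' := by
  induction L generalizing t c l with
  | nil =>
    obtain ⟨rfl, hm⟩ := h
    exact ⟨0, le_rfl, c, Path.refl (by rw [hc.mem]; exact hm), hc⟩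
  | cons s L ih =>
    obtain ⟨h1, h2, h3⟩ := h
    have hs : ζ l = s := hL 0 (by simp)
    obtain ⟨n, hn, c', hp, hr⟩ := hc.exists_path (ζ := ζ) hl (by rw [hs]; exact h1) h2
      (by rw [hs]; exact h3.mem_left)
    rw [hs] at hr
    have := t.ptr_step_le s
    obtain ⟨n', hn', c'', hp', hr'⟩ := ih h3 hr (by omega) fun i hi => by
      have := hL (i + 1) (by simpa using hi)
      rw [List.getElem_cons_succ] at this
      rw [← this]; congr 1; omega
    refine ⟨n + n', by simp only [List.length_cons]; omega, c'', hp.trans hp', ?_⟩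
    rw [List.length_cons, show l + (L.length + 1) = l + 1 + L.length by omega]
    exact hr'

/-- The symbols comparing the first `n` bits of memory with `σ`. -/
def compareList (σ : ℕ → Bool) : ℕ → List (Bool × Bool)
  | 0 => []
  | n + 1 => compareList σ n ++ [(false, σ n)]

/-- The symbols writing the bits `n`, …, `1` of `τ`. -/
def writeList (τ : ℕ → Bool) : ℕ → List (Bool × Bool)
  | 0 => []
  | n + 1 => (false, τ (n + 1)) :: writeList τ n

theorem runs_compareList {S : Set (ℕ → Bool)} (σ : ℕ → Bool) {m : ℕ → Bool} (hm : m ∈ S)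
    (done : Bool) (n : ℕ) :
    Tally.Runs S (compareList σ n) ⟨⟨false, true, done⟩, 0, m⟩
      ⟨⟨false, decide (∀ i < n, m i = σ i), done⟩, n, m⟩ := by
  induction n with
  | zero => exact ⟨by simp, hm⟩
  | succ n ih =>
    refine ih.append ⟨by simp [Flags.shift], hm, ?_, ?_⟩
    · ext i
      · simp only [Tally.step, Flags.next]
        congr 1
        rw [Bool.eq_iff_iff]
        simp only [Bool.and_eq_true, decide_eq_true_eq, beq_iff_eq]
        exact ⟨fun h i hi => (Nat.lt_succ_iff_lt_or_eq.1 hi).elim (h.1 i) fun e => e ▸ h.2.symm,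
          fun h => ⟨fun i hi => h i (by omega), (h n (by omega)).symm⟩⟩
      · simp [Tally.step, Flags.shift]
      · simp [Tally.step, Flags.bit]
    · simpa [Tally.step, Flags.bit] using hm

theorem runs_writeList {m m' : ℕ → Bool} (τ : ℕ → Bool) (hit done : Bool) (n : ℕ)
    (u : ℕ → Bool) (hu : u ∈ box m m')
    (hτ : hit = true → ∀ i, 1 ≤ i → i ≤ n → τ i = m i ∨ τ i = m' i) :
    Tally.Runs (box m m') (writeList τ n) ⟨⟨true, hit, done⟩, n, u⟩
      ⟨⟨true, hit, done⟩, 0, fun i => if hit = true ∧ 1 ≤ i ∧ i ≤ n then τ i else u i⟩ := by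
  induction n generalizing u with
  | zero =>
    refine ⟨?_, hu⟩
    congr 1
    funext i
    rw [if_neg (by omega)]
  | succ n ih =>
    refine ⟨by simp, hu, ?_⟩
    have hstep : Tally.step ⟨⟨true, hit, done⟩, n + 1, u⟩ (false, τ (n + 1)) =
        ⟨⟨true, hit, done⟩, n, Function.update u (n + 1)
          (if hit then τ (n + 1) else u (n + 1))⟩ := by
      cases hit <;> simp [Tally.step, Flags.next, Flags.shift, Flags.bit]
    rw [hstep]
    have := ih (Function.update u (n + 1) (if hit then τ (n + 1) else u (n + 1)))
      (fun i => by
        by_cases hi : i = n + 1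
        · subst hi
          cases hit
          · simpa using hu _
          · simpa using hτ rfl (n + 1) (by omega) le_rfl
        · rw [Function.update_of_ne hi]; exact hu i)
      (fun h i hi hi' => hτ h i hi (by omega))
    convert this using 2
    funext i
    by_cases hi : i = n + 1
    · subst hi; cases hit <;> simp
    · rw [Function.update_of_ne hi]
      congr 1
      rw [eq_iff_iff]
      constructor <;> rintro ⟨h, h', h''⟩ <;> exact ⟨h, h', by omega⟩

/-- The operation `U` only changes the bits of memory at the positions `1`, …, `N - 1`, and does so
depending on the first `N` bits only. -/
structure IsLocal (U : (ℕ → Bool) → ℕ → Bool) (N : ℕ) : Prop where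
  pos : 0 < N
  zero : ∀ m, U m 0 = m 0
  eq_self : ∀ m i, N ≤ i → U m i = m i
  congr : ∀ m m', (∀ i < N, m i = m' i) → ∀ i < N, U m i = U m' i

/-- The symbols that let the machine apply `U` if the first `N` bits of memory are those of `σ`. -/
def clause (U : (ℕ → Bool) → ℕ → Bool) (N : ℕ) (σ : ℕ → Bool) : List (Bool × Bool) :=
  compareList σ N ++ (true, false) :: (writeList (U σ) (N - 1) ++ [(true, false)])

/-- The invariant is that the memory is `U m` or `m` according to `done`. At the first match the
memory is still `m`, which agrees with `σ` below `N`, so by locality `U σ` gives the bits of `U m`.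
Position 0 is never written, as writing stops when the pointer gets there. -/
theorem runs_clause {U : (ℕ → Bool) → ℕ → Bool} {N : ℕ} (hU : IsLocal U N) (m σ : ℕ → Bool)
    (done : Bool) :
    Tally.Runs (box m (U m)) (clause U N σ)
      ⟨⟨false, true, done⟩, 0, if done then U m else m⟩
      ⟨⟨false, true, decide (∀ i < N, (if done then U m else m) i = σ i) || done⟩, 0,
        if decide (∀ i < N, (if done then U m else m) i = σ i) || done then U m else m⟩ := by
  set u := if done then U m else m with hu
  have huS : u ∈ box m (U m) := by
    cases done
    · exact left_mem_box _ _
    · exact right_mem_box _ _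
  set hit := decide (∀ i < N, u i = σ i) with hhit
  have hN := hU.pos
  have hτ : (hit && !done) = true →
      ∀ i, 1 ≤ i → i ≤ N - 1 → U σ i = m i ∨ U σ i = U m i := by
    intro h i hi hi'
    simp only [Bool.and_eq_true, Bool.not_eq_true', hhit, decide_eq_true_eq] at h
    rw [hu, h.2] at h
    right
    exact (hU.congr _ _ h.1 i (by omega)).symm
  refine (runs_compareList σ huS done N).append ⟨fun _ => hN, huS, ?_⟩
  have h1 : Tally.step ⟨⟨false, hit, done⟩, N, u⟩ (true, false) =
      ⟨⟨true, hit && !done, hit || done⟩, N - 1, u⟩ := by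
    simp [Tally.step, Flags.next, Flags.shift, Flags.bit]
  rw [h1]
  have hw := runs_writeList (U σ) (hit && !done) (hit || done) (N - 1) u huS hτ
  have hmem : (fun i => if (hit && !done) = true ∧ 1 ≤ i ∧ i ≤ N - 1 then U σ i else u i) =
      if hit || done then U m else m := by
    funext i
    cases hd : done with
    | true => simp [hu, hd]
    | false =>
      have hum : u = m := by simp [hu, hd]
      cases hh : hit with
      | false => simp [hum]
      | true =>
        rw [hh, eq_comm, decide_eq_true_eq, hum] at hhit
        simp only [Bool.not_false, Bool.and_self, true_and, Bool.or_false, if_true, hum]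
        split_ifs with hi
        · exact (hU.congr _ _ hhit i (by omega)).symm
        · rcases Nat.eq_zero_or_pos i with rfl | hi0
          · exact (hU.zero m).symm
          · exact (hU.eq_self m i (by omega)).symm
  rw [hmem] at hw
  have hmemS : (if hit || done then U m else m) ∈ box m (U m) := by
    split_ifs
    · exact right_mem_box _ _
    · exact left_mem_box _ _
  refine hw.append ⟨by simp [Flags.shift], hmemS, ?_, ?_⟩
  · simp [Tally.step, Flags.next, Flags.shift, Flags.bit]
  · simpa [Tally.step, Flags.bit] using hmemS

/-- All sequences of bits which vanish from `N` on. -/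
noncomputable def allPatterns (N : ℕ) : List (ℕ → Bool) :=
  (Finset.univ : Finset (Fin N → Bool)).toList.map fun f i => if h : i < N then f ⟨i, h⟩ else false

theorem exists_mem_allPatterns (N : ℕ) (m : ℕ → Bool) :
    ∃ σ ∈ allPatterns N, ∀ i < N, m i = σ i := by
  refine ⟨_, List.mem_map.2 ⟨fun i : Fin N => m i, by simp, rfl⟩, fun i hi => ?_⟩
  simp [hi]

/-- The symbols that let the machine apply `U`. -/
noncomputable def group (U : (ℕ → Bool) → ℕ → Bool) (N : ℕ) : List (Bool × Bool) :=
  (allPatterns N).flatMap (clause U N) ++ [(true, true)]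

theorem runs_clauses {U : (ℕ → Bool) → ℕ → Bool} {N : ℕ} (hU : IsLocal U N) (m : ℕ → Bool)
    (L : List (ℕ → Bool)) (done : Bool) :
    ∃ done' : Bool, Tally.Runs (box m (U m)) (L.flatMap (clause U N))
      ⟨⟨false, true, done⟩, 0, if done then U m else m⟩
      ⟨⟨false, true, done'⟩, 0, if done' then U m else m⟩ ∧
      (done = true → done' = true) ∧ ((∃ σ ∈ L, ∀ i < N, m i = σ i) → done' = true) := by
  induction L generalizing done with
  | nil =>
    refine ⟨done, ⟨rfl, ?_⟩, id, by simp⟩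
    cases done
    · exact left_mem_box _ _
    · exact right_mem_box _ _
  | cons σ L ih =>
    obtain ⟨done', h1, h2, h3⟩ := ih _
    refine ⟨done', by rw [List.flatMap_cons]; exact (runs_clause hU m σ done).append h1,
      fun h => h2 (by simp [h]), ?_⟩
    rintro ⟨σ', hσ', h⟩
    rcases List.mem_cons.1 hσ' with rfl | hσ'
    · cases done
      · exact h2 (by simpa using h)
      · exact h2 (by simp)
    · exact h3 ⟨σ', hσ', h⟩

/-- All patterns of length `N` occur, so some clause fits `m` and `done` holds at the end; the last
symbol resets it for the next group. -/
theorem runs_group {U : (ℕ → Bool) → ℕ → Bool} {N : ℕ} (hU : IsLocal U N) (m : ℕ → Bool) :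
    Tally.Runs (box m (U m)) (group U N) ⟨⟨false, true, false⟩, 0, m⟩
      ⟨⟨false, true, false⟩, 0, U m⟩ := by
  obtain ⟨done', h1, -, h3⟩ := runs_clauses hU m (allPatterns N) false
  obtain rfl := h3 (exists_mem_allPatterns N m)
  refine h1.append ⟨by simp [Flags.shift], right_mem_box _ _, ?_, ?_⟩
  · simp [Tally.step, Flags.next, Flags.shift, Flags.bit]
  · simpa [Tally.step, Flags.bit] using right_mem_box m (U m)

/-- Nonempty lists can be concatenated to an infinite stream. -/
theorem exists_stream {α : Type} [Inhabited α] (G : ℕ → List α) (hG : ∀ t, G t ≠ []) :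
    ∃ (ζ : ℕ → α) (pos : ℕ → ℕ), pos 0 = 1 ∧ (∀ t, pos (t + 1) = pos t + (G t).length) ∧
      ∀ t i (hi : i < (G t).length), ζ (pos t + i) = (G t)[i] := by
  let P : ℕ → List α := fun t => (List.range t).flatMap G
  have hP : ∀ t, P (t + 1) = P t ++ G t := fun t => by
    simp [P, List.range_succ, List.flatMap_append]
  have hlen : ∀ t, t ≤ (P t).length := by
    intro t
    induction t with
    | zero => simp
    | succ t ih =>
      have := List.length_pos_iff.2 (hG t)
      rw [hP, List.length_append]; omega
  have hpre : ∀ t d, P t <+: P (t + d) := by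
    intro t d
    induction d with
    | zero => exact List.prefix_rfl
    | succ d ih => exact ih.trans (by rw [← add_assoc, hP]; exact List.prefix_append _ _)
  -- The shift by one leaves entry 0 to the initial cell. Since `P k` has length at least `k`, the
  -- default is used only there.
  refine ⟨fun k => ((P k)[k - 1]?).getD default, fun t => 1 + (P t).length, rfl,
    fun t => by simp only [hP, List.length_append]; omega, fun t i hi => ?_⟩
  have h1 := hlen t
  obtain ⟨d, hd⟩ : ∃ d, 1 + (P t).length + i = t + 1 + d := ⟨(P t).length + i - t, by omega⟩
  obtain ⟨R, hR⟩ := hpre (t + 1) d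
  have hR' : P (1 + (P t).length + i) = P t ++ (G t ++ R) := by
    rw [hd, ← hR, hP, List.append_assoc]
  show ((P (1 + (P t).length + i))[1 + (P t).length + i - 1]?).getD default = _
  rw [hR', show 1 + (P t).length + i - 1 = (P t).length + i by omega,
    List.getElem?_append_right (by omega), Nat.add_sub_cancel_left,
    List.getElem?_append_left hi, List.getElem?_eq_getElem hi, Option.getD_some]

theorem exists_times {R B : ℕ → ℕ → Prop} {n₀ : ℕ} (h0 : R 0 n₀)
    (hs : ∀ t n, R t n → ∃ n' > n, R (t + 1) n' ∧ ∀ i, n ≤ i → i ≤ n' → B t i) :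
    ∃ T : ℕ → ℕ, T 0 = n₀ ∧ StrictMono T ∧ (∀ t, R t (T t)) ∧
      ∀ t i, T t ≤ i → i ≤ T (t + 1) → B t i := by
  choose! f hf using hs
  let T : ℕ → ℕ := fun t => Nat.rec n₀ (fun t n => f t n) t
  have hT : ∀ t, R t (T t) := by
    intro t
    induction t with
    | zero => exact h0
    | succ t ih => exact (hf t _ ih).2.1
  exact ⟨T, rfl, strictMono_nat_of_lt_succ fun t => (hf t _ (hT t)).1, hT,
    fun t => (hf t _ (hT t)).2.2⟩

/-- Applying the operations `U 0`, …, `U (t - 1)` successively. -/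
def applySeq (U : ℕ → (ℕ → Bool) → ℕ → Bool) (m : ℕ → Bool) : ℕ → ℕ → Bool
  | 0 => m
  | t + 1 => U t (applySeq U m t)

/-- For every sequence of local operations there is an oracle with which a fixed machine, started
in a certain state at the leftmost cell, applies the operations one after the other. -/
theorem exists_oracle (U : ℕ → (ℕ → Bool) → ℕ → Bool) (N : ℕ → ℕ) (hU : ∀ t, IsLocal (U t) (N t)) :
    ∃ z : CantorReal, ∀ c : Snapshot (Phase Control), c.state = .read .init → c.head = 0 →
      ∃ T : ℕ → ℕ, T 0 = 0 ∧ StrictMono T ∧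
        ∀ t i, T t ≤ i → i ≤ T (t + 1) → ((streamTable.table.step z)^[i] c).mem ∈
          box (applySeq U c.mem t) (applySeq U c.mem (t + 1)) ∧
          (i = T t → ((streamTable.table.step z)^[i] c).mem = applySeq U c.mem t) := by
  obtain ⟨ζ, pos, hpos0, hpos, hζ⟩ := exists_stream (fun t => group (U t) (N t))
    (fun t => by simp [group])
  have hposlt : ∀ t, 0 < pos t := by
    intro t
    induction t with
    | zero => omega
    | succ t ih => rw [hpos]; omega
  refine ⟨pairTape ζ, fun c hst hhead => ?_⟩
  set step := streamTable.table.step (pairTape ζ) with hstep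
  set V := applySeq U c.mem with hV
  have hc := c.eq_snapshot .init 0 hst (by simpa using hhead)
  set w : WideConfig Control := ⟨.init, 0, c.mark, c.mem⟩ with hw
  have hpath : ∀ {m m' : ℕ → Bool} {n k : ℕ} {w₁ w₂ : WideConfig Control},
      step^[n] c = w₁.snapshot →
      Path (streamTable.step ζ) WideConfig.mem (box m m') k w₁ w₂ →
      step^[n + 4 * k] c = w₂.snapshot ∧
        ∀ i, n ≤ i → i ≤ n + 4 * k → (step^[i] c).mem ∈ box m m' := by
    intro m m' n k w₁ w₂ h1 h2
    have h3 := WideTable.path_snapshot h2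
    refine ⟨by rw [add_comm, Function.iterate_add_apply, h1]; exact h3.1, fun i hi hi' => ?_⟩
    obtain ⟨j, rfl⟩ := Nat.exists_eq_add_of_le hi
    rw [add_comm, Function.iterate_add_apply, h1]
    exact h3.2 j (by omega)
  have hinit : Ready (streamTable.step ζ w) 1 ⟨⟨false, true, false⟩, 0, c.mem⟩ := by
    refine ⟨rfl, rfl, ?_, fun j hj => ?_⟩
    · simp only [WideTable.step, hw, streamTable, wideMem_eq_self]
    · obtain rfl : j = 0 := by omega
      simp [WideTable.step, hw, streamTable]
  have hp0 : Path (streamTable.step ζ) WideConfig.mem (box c.mem c.mem) 1 w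
      (streamTable.step ζ w) :=
    Path.single rfl (left_mem_box _ _) (by rw [hinit.mem]; exact left_mem_box _ _)
  have hq0 := hpath (n := 0) hc hp0
  simp only [mul_one, zero_add] at hq0
  obtain ⟨T, hT0, hTm, hTR, hTB⟩ := exists_times (n₀ := 4)
    (R := fun t n => ∃ v, Ready v (pos t) ⟨⟨false, true, false⟩, 0, V t⟩ ∧
      step^[n] c = v.snapshot)
    (B := fun t i => (step^[i] c).mem ∈ box (V t) (V (t + 1)))
    ⟨_, by rw [hpos0]; exact hinit, hq0.1⟩ (by
      rintro t n ⟨v, hv, hn⟩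
      obtain ⟨k, hk, v', hp, hv'⟩ := (runs_group (hU t) (V t)).exists_path (ζ := ζ) hv (hposlt t)
        (hζ t)
      have hk0 : 0 < k := lt_of_lt_of_le (by simp [group]) hk
      have := hpath hn hp
      refine ⟨n + 4 * k, by omega, ⟨v', ?_, this.1⟩, this.2⟩
      rw [hpos]
      exact hv')
  have hTV : ∀ t, (step^[T t] c).mem = V t := fun t => by
    obtain ⟨v, hv, hn⟩ := hTR t
    rw [hn, WideConfig.mem_snapshot, hv.mem]
  -- The four initial steps leave the memory unchanged, so they can be counted as part of the first
  -- operation.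
  refine ⟨fun t => if t = 0 then 0 else T t, rfl, ?_, fun t i hi hi' => ?_⟩
  · refine strictMono_nat_of_lt_succ fun t => ?_
    have h1 := hTm (Nat.lt_succ_self t)
    rw [Nat.succ_eq_add_one] at h1
    simp only [Nat.add_eq_zero_iff, one_ne_zero, and_false, if_false]
    split_ifs <;> omega
  · simp only [Nat.add_eq_zero_iff, one_ne_zero, and_false, if_false] at hi hi' ⊢
    rcases Nat.eq_zero_or_pos t with rfl | ht
    · refine ⟨?_, fun h => by rw [h]; rfl⟩
      rcases le_total (T 0) i with h | h
      · exact hTB 0 i h hi'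
      · exact fun j => Or.inl ((hq0.2 i (Nat.zero_le _) (by omega) j).elim id id)
    · rw [if_neg ht.ne'] at hi ⊢
      exact ⟨hTB t i hi hi', fun h => by rw [h]; exact hTV t⟩

/-! ### Simulating a step of a program by a local operation on the memory -/

/-- The cells of memory for the input tape of the `n`-th program. -/
def simInput (n h : ℕ) : ℕ := workCell (Nat.pair n (5 * h))

/-- The cells of memory for the scratch tape of the `n`-th program. -/
def simScratch (n h : ℕ) : ℕ := workCell (Nat.pair n (5 * h + 1))

/-- The cells of memory for the output tape of the `n`-th program. -/
def simOutput (n h : ℕ) : ℕ := workCell (Nat.pair n (5 * h + 2))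

/-- The cell of memory which shows whether the simulation of the `n`-th program has started. -/
def simStarted (n : ℕ) : ℕ := workCell (Nat.pair n 3)

/-- The cell of memory which shows whether the `n`-th program is in state `q` with the head at
position `h`. -/
def simControl (n q h : ℕ) : ℕ := workCell (Nat.pair n (5 * Nat.pair q h + 4))

/-- The cells of memory which belong to the `n`-th program. -/
def IsOwn (n i : ℕ) : Prop := i = outputCell n ∨ i % 5 = 4 ∧ (Nat.unpair (i / 5)).1 = n

theorem workCell_mod (k : ℕ) : workCell k % 5 = 4 := by simp only [workCell]; omega

theorem workCell_div (k : ℕ) : workCell k / 5 = k := by simp only [workCell]; omega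

theorem outputCell_mod (k : ℕ) : outputCell k % 5 ≠ 4 := by simp only [outputCell]; omega

theorem workCell_ne_outputCell (k n : ℕ) : workCell k ≠ outputCell n := fun h =>
  outputCell_mod n (h ▸ workCell_mod k)

theorem outputCell_injective : Function.Injective outputCell := fun a b h => by
  simp only [outputCell] at h; omega

theorem isOwn_workCell (n r : ℕ) : IsOwn n (workCell (Nat.pair n r)) :=
  Or.inr ⟨workCell_mod _, by simp [workCell_div]⟩

theorem not_isOwn_inputCell (n k : ℕ) : ¬ IsOwn n (inputCell k) := by
  rintro (h | h)
  · simp only [inputCell, outputCell] at h; omega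
  · have := h.1
    simp only [inputCell] at this; omega

theorem not_isOwn_of_ne {n n' i : ℕ} (h : n ≠ n') (hi : IsOwn n i) : ¬ IsOwn n' i := by
  rintro (h' | h') <;> rcases hi with hi | hi
  · exact h (outputCell_injective (hi.symm.trans h'))
  · exact outputCell_mod n' (h' ▸ hi.1)
  · exact outputCell_mod n (hi ▸ h'.1)
  · exact h (hi.2.symm.trans h'.2)

open Classical in
/-- The memory with the configuration `C` of the `n`-th program stored in it. -/
noncomputable def store {k : ℕ} (n : ℕ) (C : Config k) (m : ℕ → Bool) (i : ℕ) : Bool :=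
  if i = outputCell n then decide (C.state = State.halt k)
  else if i % 5 = 4 ∧ (Nat.unpair (i / 5)).1 = n then
    if (Nat.unpair (i / 5)).2 % 5 = 0 then C.input ((Nat.unpair (i / 5)).2 / 5)
    else if (Nat.unpair (i / 5)).2 % 5 = 1 then C.scratch ((Nat.unpair (i / 5)).2 / 5)
    else if (Nat.unpair (i / 5)).2 % 5 = 2 then C.output ((Nat.unpair (i / 5)).2 / 5)
    else if (Nat.unpair (i / 5)).2 % 5 = 3 then true
    else decide (Nat.unpair ((Nat.unpair (i / 5)).2 / 5) = (C.state.1, C.head))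
  else m i

section Store

variable {k : ℕ} (n : ℕ) (C : Config k) (m : ℕ → Bool)

theorem store_of_not_isOwn {i : ℕ} (h : ¬ IsOwn n i) : store n C m i = m i := by
  rw [IsOwn, not_or] at h
  rw [store, if_neg h.1, if_neg h.2]

theorem store_outputCell : store n C m (outputCell n) = decide (C.state = State.halt k) := by
  rw [store, if_pos rfl]

theorem store_simInput (h : ℕ) : store n C m (simInput n h) = C.input h := by
  simp [store, simInput, workCell_ne_outputCell, workCell_mod, workCell_div]

theorem store_simScratch (h : ℕ) : store n C m (simScratch n h) = C.scratch h := by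
  have h1 : (5 * h + 1) % 5 = 1 := by omega
  have h2 : (5 * h + 1) / 5 = h := by omega
  simp [store, simScratch, workCell_ne_outputCell, workCell_mod, workCell_div, h1, h2]

theorem store_simOutput (h : ℕ) : store n C m (simOutput n h) = C.output h := by
  have h1 : (5 * h + 2) % 5 = 2 := by omega
  have h2 : (5 * h + 2) / 5 = h := by omega
  simp [store, simOutput, workCell_ne_outputCell, workCell_mod, workCell_div, h1, h2]

theorem store_simStarted : store n C m (simStarted n) = true := by
  simp [store, simStarted, workCell_ne_outputCell, workCell_mod, workCell_div]

theorem store_simControl (q : State k) (h : ℕ) :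
    store n C m (simControl n q h) = true ↔ C.state = q ∧ C.head = h := by
  have h1 : (5 * Nat.pair q h + 4) % 5 = 4 := by omega
  have h2 : (5 * Nat.pair q h + 4) / 5 = Nat.pair q h := by omega
  simp [store, simControl, workCell_ne_outputCell, workCell_mod, workCell_div, h1, h2,
    Fin.ext_iff]
  constructor <;> rintro ⟨a, b⟩ <;> exact ⟨a.symm, b.symm⟩

end Store

open Classical in
/-- The state and the position of the head of the `n`-th program, read off the memory after `j`
steps since the last limit. -/
noncomputable def loadControl (k n j : ℕ) (m : ℕ → Bool) : State k × ℕ :=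
  -- After a limit the control cells contain superior limits without meaning, so only the started
  -- bit and the halting bit are consulted.
  if j = 0 then
    (if m (simStarted n) then if m (outputCell n) then State.halt k else State.limit k
      else State.start k, 0)
  -- After `j` steps the head is at most at `j`. The bound keeps the search among control cells
  -- rewritten since the limit.
  else if h : ∃ s : State k × ℕ, s.2 ≤ j ∧ m (simControl n s.1 s.2) = true then h.choose
  else (State.start k, 0)

/-- The configuration of the `n`-th program, read off the memory after `j` steps since the last
limit. -/
noncomputable def load (k n j : ℕ) (m : ℕ → Bool) : Config k where
  state := (loadControl k n j m).1
  head := (loadControl k n j m).2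
  -- The input `n` is not in memory at the outset; it is supplied at the first step and stored by
  -- it.
  input h := if j = 0 ∧ m (simStarted n) = false then ofNat n h else m (simInput n h)
  scratch h := m (simScratch n h)
  output h := m (simOutput n h)

/-- The function which agrees with `a` below `N` and with `b` from `N` on. -/
def splice (N : ℕ) (a b : ℕ → Bool) (i : ℕ) : Bool := if i < N then a i else b i

/-- A bound for the cells of memory which matter for the `n`-th program when the positions of the
head are at most `B`. -/
def simBound (k n B : ℕ) : ℕ :=
  ∑ h ∈ Finset.range (B + 1), (inputCell h + simInput n h + simScratch n h + simOutput n h +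
    ∑ q ∈ Finset.range (k + 3), simControl n q h) + outputCell n + simStarted n + 1

theorem lt_simBound (k n B h : ℕ) (hB : h ≤ B) : inputCell h < simBound k n B ∧
    simInput n h < simBound k n B ∧ simScratch n h < simBound k n B ∧
    simOutput n h < simBound k n B ∧ ∀ q : State k, simControl n q h < simBound k n B := by
  have h1 := Finset.single_le_sum (f := fun h => inputCell h + simInput n h + simScratch n h +
    simOutput n h + ∑ q ∈ Finset.range (k + 3), simControl n q h) (fun _ _ => Nat.zero_le _)
    (Finset.mem_range.2 (Nat.lt_succ_of_le hB))
  have h2 : ∀ q : State k, simControl n q h ≤ ∑ q ∈ Finset.range (k + 3), simControl n q h :=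
    fun q => Finset.single_le_sum (f := fun q => simControl n q h) (fun _ _ => Nat.zero_le _)
      (Finset.mem_range.2 q.2)
  simp only [Nat.succ_eq_add_one] at h1
  refine ⟨?_, ?_, ?_, ?_, fun q => ?_⟩
  all_goals simp only [simBound]
  · omega
  · omega
  · omega
  · omega
  · have := h2 q
    omega

theorem outputCell_lt_simBound (k n B : ℕ) : outputCell n < simBound k n B := by
  simp only [simBound]; omega

theorem simStarted_lt_simBound (k n B : ℕ) : simStarted n < simBound k n B := by
  simp only [simBound]; omega

/-- The operation on the memory which simulates the step number `j` since the last limit of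
the program `p`, the `n`-th one. -/
noncomputable def simStep (n : ℕ) (p : Program) (j : ℕ) (m : ℕ → Bool) : ℕ → Bool :=
  -- The head is at most at `j + 1` after this step; the summand `n` makes the first step store all
  -- ones of the input `n`.
  let N := simBound p.1 n (n + j + 1)
  let m' := splice N m fun _ => false
  splice N (store n (step p (fun k => m' (inputCell k)) (load p.1 n j m')) m') m

theorem simStep_of_not_isOwn {n i : ℕ} (p : Program) (j : ℕ) (m : ℕ → Bool) (h : ¬ IsOwn n i) :
    simStep n p j m i = m i := by
  simp only [simStep, splice, store_of_not_isOwn _ _ _ h]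
  split_ifs <;> rfl

theorem isLocal_simStep (n : ℕ) (p : Program) (j : ℕ) :
    IsLocal (simStep n p j) (simBound p.1 n (n + j + 1)) where
  pos := Nat.succ_pos _
  zero m := simStep_of_not_isOwn p j m (not_isOwn_inputCell n 0)
  eq_self m i hi := by simp only [simStep]; rw [splice, if_neg (by omega)]
  congr m m' h i hi := by
    have : splice (simBound p.1 n (n + j + 1)) m (fun _ => false) =
        splice (simBound p.1 n (n + j + 1)) m' (fun _ => false) := by
      funext i
      simp only [splice]
      split_ifs with hi
      · exact h i hi
      · rfl
    simp only [simStep, this]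
    rw [splice, splice, if_pos hi, if_pos hi]

/-! ### Locality of steps -/

theorem step_congr (p : Program) {z z' : CantorReal} {c d : Config p.1} (hs : c.state = d.state)
    (hh : c.head = d.head) (hz : z c.head = z' c.head) (hi : c.input c.head = d.input c.head)
    (hsc : c.scratch c.head = d.scratch c.head) (ho : c.output c.head = d.output c.head) :
    (step p z c).state = (step p z' d).state ∧ (step p z c).head = (step p z' d).head ∧
      (∀ h, c.input h = d.input h → (step p z c).input h = (step p z' d).input h) ∧
      (∀ h, c.scratch h = d.scratch h → (step p z c).scratch h = (step p z' d).scratch h) ∧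
      ∀ h, c.output h = d.output h → (step p z c).output h = (step p z' d).output h := by
  obtain ⟨cs, ch, ci, csc, co⟩ := c
  obtain ⟨ds, dh, di, dsc, d_o⟩ := d
  simp only at hs hh hz hi hsc ho
  subst hs hh
  unfold step
  by_cases h : cs = State.halt p.1
  · simp only [h, if_true]
    exact ⟨trivial, trivial, fun _ => id, fun _ => id, fun _ => id⟩
  · simp only [h, if_false, hz, hi, hsc, ho]
    refine ⟨trivial, trivial, ?_, ?_, ?_⟩ <;> intro h' e <;>
      simp only [Function.update_apply] <;> split_ifs <;> first | rfl | exact e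

theorem step_of_ne (p : Program) (z : CantorReal) (c : Config p.1) {h : ℕ} (hh : h ≠ c.head) :
    (step p z c).input h = c.input h ∧ (step p z c).scratch h = c.scratch h ∧
      (step p z c).output h = c.output h := by
  unfold step
  split_ifs
  · exact ⟨rfl, rfl, rfl⟩
  · exact ⟨Function.update_of_ne hh _ _, Function.update_of_ne hh _ _,
      Function.update_of_ne hh _ _⟩

theorem step_head_le (p : Program) (z : CantorReal) (c : Config p.1) :
    (step p z c).head ≤ c.head + 1 := by
  unfold step
  split_ifs
  · exact Nat.le_succ _
  · simp only
    split_ifs <;> omega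

/-! ### Correctness of the simulation of a step -/

/-- The memory represents the configuration `C` of the `n`-th program `p` with oracle `x`, `j` steps
after a limit. -/
structure Represents (n : ℕ) (p : Program) (x : CantorReal) (j : ℕ) (C : Config p.1)
    (m : ℕ → Bool) : Prop where
  oracle : ∀ k, m (inputCell k) = x k
  input : ∀ h, (load p.1 n j m).input h = C.input h
  scratch : ∀ h, m (simScratch n h) = C.scratch h
  output : ∀ h, m (simOutput n h) = C.output h
  halt : m (outputCell n) = decide (C.state = State.halt p.1)
  head_le : C.head ≤ j
  started : 0 < j → m (simStarted n) = true
  fresh : j = 0 → m (simStarted n) = false → ∀ h, m (simInput n h) = false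
  state : j = 0 → C.state = (loadControl p.1 n 0 m).1
  -- Each step rewrites all control cells for positions up to the bound, so leftovers from before
  -- the limit survive only further out.
  control : 0 < j → ∀ (q : State p.1) (h : ℕ), h ≤ j →
    (m (simControl n q h) = true ↔ C.state = q ∧ C.head = h)

/-- This lets the programs share the memory: steps of other programs change neither the cells owned
by this one nor the copy of `x`. -/
theorem Represents.congr {n : ℕ} {p : Program} {x : CantorReal} {j : ℕ} {C : Config p.1}
    {m m' : ℕ → Bool} (h : Represents n p x j C m) (hown : ∀ i, IsOwn n i → m' i = m i)
    (hin : ∀ k, m' (inputCell k) = m (inputCell k)) : Represents n p x j C m' := by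
  have h1 : ∀ r, m' (workCell (Nat.pair n r)) = m (workCell (Nat.pair n r)) := fun r =>
    hown _ (isOwn_workCell n r)
  have h2 : m' (outputCell n) = m (outputCell n) := hown _ (Or.inl rfl)
  have hst : m' (simStarted n) = m (simStarted n) := h1 _
  have hin' : ∀ h, m' (simInput n h) = m (simInput n h) := fun h => h1 _
  constructor
  · intro k; rw [hin]; exact h.oracle k
  · intro r
    rw [← h.input r]
    simp only [load, hst, hin']
  · intro r; exact (h1 _).trans (h.scratch r)
  · intro r; exact (h1 _).trans (h.output r)
  · rw [h2]; exact h.halt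
  · exact h.head_le
  · intro hj; rw [hst]; exact h.started hj
  · intro hj hs r; rw [hst] at hs; rw [hin']; exact h.fresh hj hs r
  · intro hj
    rw [h.state hj]
    simp only [loadControl, if_true, hst, h2]
  · intro hj q r hr
    rw [← h.control hj q r hr]
    exact Eq.congr_left (h1 _)

/-- A step depends on and changes only what is under the head, which lies within the bound. So
truncating the memory there does no harm, and tape cells beyond it keep their values. -/
theorem Represents.simStep {n : ℕ} {p : Program} {x : CantorReal} {j : ℕ} {C : Config p.1}
    {m : ℕ → Bool} (hR : Represents n p x j C m) :
    Represents n p x (j + 1) (step p x C) (simStep n p j m) := by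
  set N := simBound p.1 n (n + j + 1) with hN
  set m' := splice N m fun _ => false with hm'
  have hlt : ∀ i, i < N → m' i = m i := fun i hi => by simp [hm', splice, hi]
  have hb := lt_simBound p.1 n (n + j + 1)
  have hst : m' (simStarted n) = m (simStarted n) := hlt _ (simStarted_lt_simBound _ _ _)
  have hout : m' (outputCell n) = m (outputCell n) := hlt _ (outputCell_lt_simBound _ _ _)
  set D := load p.1 n j m' with hD
  have hctrl : (loadControl p.1 n j m') = (C.state, C.head) := by
    rcases Nat.eq_zero_or_pos j with rfl | hj
    · have h1 := hR.state rfl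
      have h2 := Nat.le_zero.1 hR.head_le
      rw [h1, h2]
      simp only [loadControl, if_true, hst, hout]
    · have hex : ∃ s : State p.1 × ℕ, s.2 ≤ j ∧ m' (simControl n s.1 s.2) = true :=
        ⟨(C.state, C.head), hR.head_le, by
          rw [hlt _ ((hb C.head (by have := hR.head_le; omega)).2.2.2.2 C.state)]
          exact (hR.control hj _ _ hR.head_le).2 ⟨rfl, rfl⟩⟩
      rw [loadControl, if_neg hj.ne', dif_pos hex]
      obtain ⟨h1, h2⟩ := hex.choose_spec
      rw [hlt _ ((hb _ (by omega)).2.2.2.2 _)] at h2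
      obtain ⟨h3, h4⟩ := (hR.control hj _ _ h1).1 h2
      exact Prod.ext h3.symm h4.symm
  have hDs : C.state = D.state := (congrArg Prod.fst hctrl).symm
  have hDh : C.head = D.head := (congrArg Prod.snd hctrl).symm
  have hDi : ∀ h, simInput n h < N → C.input h = D.input h := fun h hh => by
    rw [← hR.input h]
    simp only [hD, load, hst, hlt _ hh]
  have hDsc : ∀ h, simScratch n h < N → C.scratch h = D.scratch h := fun h hh => by
    rw [← hR.scratch h]
    simp only [hD, load, hlt _ hh]
  have hDo : ∀ h, simOutput n h < N → C.output h = D.output h := fun h hh => by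
    rw [← hR.output h]
    simp only [hD, load, hlt _ hh]
  have hhead := hR.head_le
  have hbh := hb C.head (by omega)
  obtain ⟨e1, e2, e3, e4, e5⟩ := step_congr p (z := x) (z' := fun k => m' (inputCell k)) hDs hDh
    (by rw [hlt _ hbh.1]; exact (hR.oracle _).symm) (hDi _ hbh.2.1) (hDsc _ hbh.2.2.1)
    (hDo _ hbh.2.2.2.1)
  set D' := step p (fun k => m' (inputCell k)) D with hD'
  have hU : ∀ i, i < N → ITTM.simStep n p j m i = store n D' m' i := fun i hi => by
    change splice N (store n D' m') m i = _
    rw [splice, if_pos hi]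
  have hU' : ∀ i, ¬ i < N → ITTM.simStep n p j m i = m i := fun i hi => by
    change splice N (store n D' m') m i = _
    rw [splice, if_neg hi]
  have hne : ∀ h, n + j + 1 < h → h ≠ C.head := fun h hh => by omega
  have hsh := step_head_le p x C
  have hUst : ITTM.simStep n p j m (simStarted n) = true := by
    rw [hU _ (simStarted_lt_simBound _ _ _), store_simStarted]
  constructor
  · intro k
    rw [simStep_of_not_isOwn _ _ _ (not_isOwn_inputCell n k), hR.oracle]
  · intro h
    simp only [load, Nat.succ_ne_zero, false_and, if_false]
    by_cases hh : simInput n h < N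
    · rw [hU _ hh, store_simInput, ← e3 h (hDi h hh)]
    · have hBh : n + j + 1 < h := by
        by_contra hc
        exact hh (hb h (by omega)).2.1
      rw [hU' _ hh, (step_of_ne p x C (hne h hBh)).1, ← hR.input h]
      simp only [load]
      -- At the very first step an input cell beyond the bound was not stored, but its value is 0
      -- because `h > n`.
      split_ifs with hf
      · rw [hR.fresh hf.1 hf.2]
        simp [ofNat]; omega
      · rfl
  · intro h
    by_cases hh : simScratch n h < N
    · rw [hU _ hh, store_simScratch, ← e4 h (hDsc h hh)]
    · have hBh : n + j + 1 < h := by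
        by_contra hc
        exact hh (hb h (by omega)).2.2.1
      rw [hU' _ hh, (step_of_ne p x C (hne h hBh)).2.1, ← hR.scratch h]
  · intro h
    by_cases hh : simOutput n h < N
    · rw [hU _ hh, store_simOutput, ← e5 h (hDo h hh)]
    · have hBh : n + j + 1 < h := by
        by_contra hc
        exact hh (hb h (by omega)).2.2.2.1
      rw [hU' _ hh, (step_of_ne p x C (hne h hBh)).2.2, ← hR.output h]
  · rw [hU _ (outputCell_lt_simBound _ _ _), store_outputCell, e1]
  · omega
  · exact fun _ => hUst
  · intro hj; omega
  · intro hj; omega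
  · intro _ q h hh
    rw [hU _ ((hb h (by omega)).2.2.2.2 q), store_simControl, e1, e2]

/-! ### Simulating all programs -/

/-- How often the `n`-th program is considered before time `t`. -/
def visits (n t : ℕ) : ℕ := Nat.count (fun s => (Nat.unpair s).1 = n) t

theorem visits_succ (n t : ℕ) :
    visits n (t + 1) = visits n t + if (Nat.unpair t).1 = n then 1 else 0 :=
  Nat.count_succ _ _

theorem visits_le (n t : ℕ) : visits n t ≤ t := Nat.count_le _

theorem visits_mono (n : ℕ) : Monotone (visits n) := Nat.count_monotone _

theorem exists_visits_eq (n j : ℕ) : ∃ t, visits n t = j := by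
  refine ⟨Nat.nth (fun s => (Nat.unpair s).1 = n) j, Nat.count_nth_of_infinite ?_ j⟩
  refine Set.infinite_of_injective_forall_mem (f := fun i => Nat.pair n i) (fun a b h => ?_)
    fun i => ?_
  · simpa using h
  · simp

/-- The sequence of operations on the memory which simulates all programs simultaneously. -/
noncomputable def simSeq (t : ℕ) : (ℕ → Bool) → ℕ → Bool :=
  match Encodable.decode₂ Program (Nat.unpair t).1 with
  | none => id
  | some p => simStep (Nat.unpair t).1 p (visits (Nat.unpair t).1 t)

theorem exists_isLocal_simSeq (t : ℕ) : ∃ N, IsLocal (simSeq t) N := by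
  unfold simSeq
  split
  · exact ⟨1, one_pos, fun _ => rfl, fun _ _ _ => rfl, fun _ _ h => h⟩
  · exact ⟨_, isLocal_simStep _ _ _⟩

theorem simSeq_of_not_isOwn (t : ℕ) (m : ℕ → Bool) {i : ℕ} (h : ¬ IsOwn (Nat.unpair t).1 i) :
    simSeq t m i = m i := by
  unfold simSeq
  generalize Encodable.decode₂ Program (Nat.unpair t).1 = o
  cases o
  · rfl
  · exact simStep_of_not_isOwn _ _ _ h

theorem simSeq_of_eq {p : Program} {t : ℕ} (h : p.index = (Nat.unpair t).1) :
    simSeq t = simStep p.index p (visits p.index t) := by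
  have : Encodable.decode₂ Program (Nat.unpair t).1 = some p := Encodable.decode₂_eq_some.2 h
  simp only [simSeq, this, h]

theorem Represents.applySeq {p : Program} {x : CantorReal} {a : Ordinal.{0}} {m : ℕ → Bool}
    (h : Represents p.index p x 0 (run p x (ofNat p.index) a) m) (t : ℕ) :
    Represents p.index p x (visits p.index t)
      (run p x (ofNat p.index) (a + (visits p.index t : ℕ))) (applySeq simSeq m t) := by
  induction t with
  | zero => simpa [visits, ITTM.applySeq] using h
  | succ t ih =>
    rw [visits_succ]
    by_cases ht : (Nat.unpair t).1 = p.index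
    · rw [if_pos ht, run_add_nat, Function.iterate_succ_apply', ← run_add_nat]
      simp only [ITTM.applySeq]
      rw [simSeq_of_eq ht.symm]
      exact ih.simStep
    · rw [if_neg ht, add_zero]
      exact ih.congr (fun i hi => simSeq_of_not_isOwn t _ (not_isOwn_of_ne (Ne.symm ht) hi))
        fun k => simSeq_of_not_isOwn t _ (not_isOwn_inputCell _ _)

/-! ### Comparing superior limits blockwise -/

open Ordinal in
/-- Within the block of stages starting at `ω * a`, the values of `g` are those of `f`, up to a
delay. -/
structure Tracks (g f : Ordinal.{0} → Bool) (a : Ordinal.{0}) : Prop where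
  -- Stage 0 is excepted: the input and the started bit are not yet in memory then.
  shown : ∀ j : ℕ, 0 < j ∨ 0 < a → ∃ i : ℕ, j ≤ i ∧ g (ω * a + i) = f (ω * a + j)
  late : ∀ n : ℕ, ∃ I : ℕ, ∀ i : ℕ, I ≤ i → ∃ j : ℕ, n ≤ j ∧ g (ω * a + i) = f (ω * a + j)
  all : 0 < a → ∀ i : ℕ, ∃ j : ℕ, g (ω * a + i) = f (ω * a + j)

open Ordinal

theorem exists_eq_omega0_mul_add (b : Ordinal.{0}) : ∃ (a : Ordinal.{0}) (n : ℕ), b = ω * a + n := by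
  obtain ⟨n, hn⟩ := lt_omega0.1 (mod_lt b omega0_ne_zero)
  exact ⟨b / ω, n, by rw [← hn, div_add_mod]⟩

theorem omega0_mul_add_lt {a b : Ordinal.{0}} (h : a < b) (n : ℕ) : ω * a + n < ω * b := by
  have h1 : ω * a + n < ω * a + ω := by
    exact add_lt_add_right (natCast_lt_omega0 n) _
  refine h1.trans_le ?_
  rw [← mul_add_one]
  exact mul_le_mul_right (Order.add_one_le_of_lt h) _

theorem lt_of_omega0_mul_add_lt {a b : Ordinal.{0}} {n : ℕ} (h : ω * a + n < ω * b) : a < b := by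
  by_contra hc
  exact absurd (h.trans_le (mul_le_mul_right (not_lt.1 hc) ω)) (not_lt.2 le_self_add)

theorem omega0_mul_add_le {a a' : Ordinal.{0}} {n n' : ℕ} (h : ω * a + n ≤ ω * a' + n') :
    a < a' ∨ a = a' ∧ n ≤ n' := by
  rcases lt_trichotomy a a' with h1 | rfl | h1
  · exact Or.inl h1
  · exact Or.inr ⟨rfl, by simpa using h⟩
  · exact absurd (omega0_mul_add_lt h1 n') (not_lt.2 (le_self_add.trans h))

theorem isSuccLimit_omega0_mul {b : Ordinal.{0}} (hb : 0 < b) : Order.IsSuccLimit (ω * b) :=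
  isSuccLimit_mul_left isSuccLimit_omega0 hb

/-- If `g` is the same as `f` up to a delay in all blocks before `b`, then they have the same
superior limit. -/
theorem Tracks.limsup {g f : Ordinal.{0} → Bool} {b : Ordinal.{0}} (h : ∀ a < b, Tracks g f a) :
    (∀ α < ω * b, ∃ β < ω * b, α ≤ β ∧ g β = true) ↔
      ∀ α < ω * b, ∃ β < ω * b, α ≤ β ∧ f β = true := by
  constructor <;> intro H α hα <;> obtain ⟨a, n, rfl⟩ := exists_eq_omega0_mul_add α <;>
    have hab := lt_of_omega0_mul_add_lt hα
  · obtain ⟨I, hI⟩ := (h a hab).late n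
    obtain ⟨β, hβ, hle, hgβ⟩ := H (ω * a + (I : ℕ)) (omega0_mul_add_lt hab I)
    obtain ⟨a', i, rfl⟩ := exists_eq_omega0_mul_add β
    have hab' := lt_of_omega0_mul_add_lt hβ
    rcases omega0_mul_add_le hle with h1 | ⟨rfl, h1⟩
    · obtain ⟨j, hj⟩ := (h a' hab').all (bot_le.trans_lt h1) i
      exact ⟨_, omega0_mul_add_lt hab' j,
        (omega0_mul_add_lt h1 n).le.trans le_self_add, by rw [← hj, hgβ]⟩
    · obtain ⟨j, hj, hgj⟩ := hI i h1
      exact ⟨_, omega0_mul_add_lt hab' j, by gcongr, by rw [← hgj, hgβ]⟩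
  -- Asking for `n + 1` makes `j` positive if `β` lies in the same block, as `shown` requires.
  · obtain ⟨β, hβ, hle, hfβ⟩ := H (ω * a + (n + 1 : ℕ)) (omega0_mul_add_lt hab _)
    obtain ⟨a', j, rfl⟩ := exists_eq_omega0_mul_add β
    have hab' := lt_of_omega0_mul_add_lt hβ
    have hle' := omega0_mul_add_le hle
    obtain ⟨i, hi, hg⟩ := (h a' hab').shown j (hle'.elim (fun h1 => Or.inr (bot_le.trans_lt h1))
      fun h1 => Or.inl (by omega))
    refine ⟨_, omega0_mul_add_lt hab' i, ?_, by rw [hg, hfβ]⟩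
    rcases hle' with h1 | ⟨rfl, h1⟩
    · exact (omega0_mul_add_lt h1 n).le.trans le_self_add
    · gcongr
      omega

theorem exists_between_of_strictMono {T : ℕ → ℕ} (hT0 : T 0 = 0) (hT : StrictMono T) (i : ℕ) :
    ∃ t, T t ≤ i ∧ i ≤ T (t + 1) := by
  induction i with
  | zero => exact ⟨0, hT0.le, Nat.zero_le _⟩
  | succ i ih =>
    obtain ⟨t, h1, h2⟩ := ih
    rcases Nat.lt_or_ge i (T (t + 1)) with h | h
    · exact ⟨t, by omega, h⟩
    · have := hT (Nat.lt_succ_self (t + 1))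
      exact ⟨t + 1, by omega, by rw [Nat.succ_eq_add_one] at this; omega⟩

/-- A cell tracks `f` if it shows the values of `f` after each operation on the memory. -/
theorem tracks_of_applySeq {g f : Ordinal.{0} → Bool} {a : Ordinal.{0}} {n : ℕ} {V : ℕ → Bool}
    {T : ℕ → ℕ} (hT0 : T 0 = 0) (hT : StrictMono T)
    (hg : ∀ t i, T t ≤ i → i ≤ T (t + 1) →
      g (ω * a + (i : ℕ)) = V t ∨ g (ω * a + (i : ℕ)) = V (t + 1))
    (hg' : ∀ t, g (ω * a + (T t : ℕ)) = V t)
    (hV : ∀ t, 0 < visits n t ∨ 0 < a → V t = f (ω * a + (visits n t : ℕ))) : Tracks g f a where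
  shown j hj := by
    obtain ⟨t, rfl⟩ := exists_visits_eq n j
    exact ⟨T t, (visits_le n t).trans (hT.le_apply), by rw [hg', hV t hj]⟩
  late k := by
    -- With `k + 1` the number of visits is positive from `t₁` on, so `hV` applies in block 0 too.
    obtain ⟨t₁, ht₁⟩ := exists_visits_eq n (k + 1)
    refine ⟨T t₁, fun i hi => ?_⟩
    obtain ⟨t, h1, h2⟩ := exists_between_of_strictMono hT0 hT i
    have h3 : t₁ ≤ t + 1 := hT.le_iff_le.1 (hi.trans h2)
    have h4 : k + 1 ≤ visits n (t + 1) := ht₁ ▸ visits_mono n h3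
    rcases Nat.lt_or_ge t t₁ with h5 | h5
    · obtain rfl : i = T (t + 1) := le_antisymm h2 ((hT.monotone h5).trans hi)
      exact ⟨_, by omega, (hg' _).trans (hV _ (Or.inl (by omega)))⟩
    · have h6 : k + 1 ≤ visits n t := ht₁ ▸ visits_mono n h5
      rcases hg t i h1 h2 with h | h
      · exact ⟨_, by omega, h.trans (hV _ (Or.inl (by omega)))⟩
      · exact ⟨_, by omega, h.trans (hV _ (Or.inl (by omega)))⟩
  all ha i := by
    obtain ⟨t, h1, h2⟩ := exists_between_of_strictMono hT0 hT i
    rcases hg t i h1 h2 with h | h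
    · exact ⟨_, h.trans (hV _ (Or.inr ha))⟩
    · exact ⟨_, h.trans (hV _ (Or.inr ha))⟩

/-! ### The run of the simulating machine -/

theorem run_state_halt_of_le {p : Program} {z x : CantorReal} {a b : Ordinal.{0}} (hab : a ≤ b)
    (ha : (run p z x a).state = State.halt p.1) : (run p z x b).state = State.halt p.1 := by
  induction b using Ordinal.limitRecOn with
  | zero => rwa [← nonpos_iff_eq_zero.1 hab]
  | add_one b ih =>
    rw [← Order.succ_eq_add_one] at hab ⊢
    rcases Order.le_succ_iff_eq_or_le.1 hab with rfl | h
    · exact ha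
    · rw [run_succ, step, if_pos (ih h)]
      exact ih h
  | limit b hb ih =>
    rcases hab.eq_or_lt with rfl | h
    · exact ha
    · rw [run_limit p z x hb]
      exact if_pos ⟨a, h, ha⟩

theorem State.limit_ne_halt (n : ℕ) : State.limit n ≠ State.halt n := by
  intro h
  have h := congrArg Fin.val h
  simp only [State.limit, State.halt, Fin.coe_ofNat_eq_mod] at h
  rw [Nat.mod_eq_of_lt (by omega), Nat.mod_eq_of_lt (by omega)] at h
  omega

theorem State.start_ne_halt (n : ℕ) : State.start n ≠ State.halt n := by
  intro h
  have h := congrArg Fin.val h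
  simp only [State.start, State.halt, Fin.coe_ofNat_eq_mod] at h
  rw [Nat.mod_eq_of_lt (by omega), Nat.mod_eq_of_lt (by omega)] at h
  omega

theorem Snapshot.mem_inputCell {Q : Type} (c : Snapshot Q) (k : ℕ) :
    c.mem (inputCell k) = c.input k := by
  have h1 : inputCell k % 5 = k % 2 := by simp only [inputCell]; omega
  have h2 : inputCell k / 5 = k / 2 := by simp only [inputCell]; omega
  rw [Snapshot.mem, h1, h2]
  rcases Nat.mod_two_eq_zero_or_one k with h | h
  · rw [if_pos h]; congr 1; omega
  · rw [if_neg (by omega), if_pos h]; congr 1; omega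

theorem Snapshot.mem_outputCell {Q : Type} (c : Snapshot Q) (k : ℕ) :
    c.mem (outputCell k) = c.output k := by
  have h1 : outputCell k % 5 = 2 + k % 2 := by simp only [outputCell]; omega
  have h2 : outputCell k / 5 = k / 2 := by simp only [outputCell]; omega
  rw [Snapshot.mem, h1, h2, if_neg (by omega), if_neg (by omega)]
  rcases Nat.mod_two_eq_zero_or_one k with h | h
  · rw [if_pos (by omega)]; congr 1; omega
  · rw [if_neg (by omega), if_pos (by omega)]; congr 1; omega

theorem Snapshot.mem_workCell {Q : Type} (c : Snapshot Q) (k : ℕ) :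
    c.mem (workCell k) = c.scratch (2 * k + 1) := by
  rw [Snapshot.mem, workCell_mod, workCell_div]
  rfl

theorem mem_run_limit {Q : Type} {p : Program} (dec : State p.1 → Q) (z x : CantorReal)
    {l : Ordinal.{0}} (hl : Order.IsSuccLimit l) (i : ℕ) :
    ((run p z x l).snapshot dec).mem i = true ↔
      ∀ α < l, ∃ β < l, α ≤ β ∧ ((run p z x β).snapshot dec).mem i = true := by
  rw [run_limit p z x hl]
  simp only [Snapshot.mem, Config.snapshot, limitConfig]
  split_ifs <;> rw [limsupTape_eq_true] <;> simp only [exists_prop]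

theorem simStep_simStarted (n : ℕ) (p : Program) (j : ℕ) (m : ℕ → Bool) :
    simStep n p j m (simStarted n) = true := by
  simp only [simStep]
  rw [splice, if_pos (simStarted_lt_simBound _ _ _), store_simStarted]

theorem applySeq_simStarted {p : Program} {m : ℕ → Bool} (h : m (simStarted p.index) = true)
    (t : ℕ) : applySeq simSeq m t (simStarted p.index) = true := by
  induction t with
  | zero => exact h
  | succ t ih =>
    rw [applySeq]
    by_cases ht : (Nat.unpair t).1 = p.index
    · rw [simSeq_of_eq ht.symm, simStep_simStarted]
    · have hown : IsOwn p.index (simStarted p.index) := isOwn_workCell _ _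
      rw [simSeq_of_not_isOwn t _ (not_isOwn_of_ne (Ne.symm ht) hown), ih]

theorem applySeq_inputCell (m : ℕ → Bool) (k t : ℕ) :
    applySeq simSeq m t (inputCell k) = m (inputCell k) := by
  induction t with
  | zero => rfl
  | succ t ih => rw [applySeq, simSeq_of_not_isOwn t _ (not_isOwn_inputCell _ _), ih]

theorem applySeq_outputCell {n : ℕ} (hn : ∀ p : Program, p.index ≠ n) (m : ℕ → Bool) (t : ℕ) :
    applySeq simSeq m t (outputCell n) = m (outputCell n) := by
  induction t with
  | zero => rfl
  | succ t ih =>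
    rw [applySeq]
    by_cases ht : (Nat.unpair t).1 = n
    · have : Encodable.decode₂ Program (Nat.unpair t).1 = none := by
        rw [Option.eq_none_iff_forall_not_mem]
        intro p hp
        exact hn p ((Encodable.mem_decode₂.1 hp).trans ht)
      simp only [simSeq, this, id, ih]
    · rw [simSeq_of_not_isOwn t _ (not_isOwn_of_ne (Ne.symm ht) (Or.inl rfl)), ih]

/-- The memory at the stage `ω * a` represents the configurations of all programs at this stage. -/
structure RepresentsAll (x : CantorReal) (a : Ordinal.{0}) (m : ℕ → Bool) : Prop where
  oracle : ∀ k, m (inputCell k) = x k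
  rep : ∀ q : Program, Represents q.index q x 0 (run q x (ofNat q.index) (ω * a)) m
  started : 0 < a → ∀ q : Program, m (simStarted q.index) = true
  unused : ∀ n, (∀ q : Program, q.index ≠ n) → m (outputCell n) = false

/-- The cells of the memory, as functions `g i` of the stage, track the computations of all
programs. -/
structure TracksAll (x : CantorReal) (g : ℕ → Ordinal.{0} → Bool) (a : Ordinal.{0}) : Prop where
  oracle : ∀ k, Tracks (g (inputCell k)) (fun _ => x k) a
  input : ∀ (q : Program) h, Tracks (g (simInput q.index h))
    (fun b => (run q x (ofNat q.index) b).input h) a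
  scratch : ∀ (q : Program) h, Tracks (g (simScratch q.index h))
    (fun b => (run q x (ofNat q.index) b).scratch h) a
  output : ∀ (q : Program) h, Tracks (g (simOutput q.index h))
    (fun b => (run q x (ofNat q.index) b).output h) a
  halt : ∀ q : Program, Tracks (g (outputCell q.index))
    (fun b => decide ((run q x (ofNat q.index) b).state = State.halt q.1)) a
  started : ∀ q : Program, Tracks (g (simStarted q.index)) (fun _ => true) a
  unused : ∀ n, (∀ q : Program, q.index ≠ n) → Tracks (g (outputCell n)) (fun _ => false) a

theorem RepresentsAll.tracksAll {x : CantorReal} {a : Ordinal.{0}} {m : ℕ → Bool}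
    (h : RepresentsAll x a m) {g : ℕ → Ordinal.{0} → Bool} {T : ℕ → ℕ} (hT0 : T 0 = 0)
    (hT : StrictMono T)
    (hg : ∀ t i, T t ≤ i → i ≤ T (t + 1) → (fun c => g c (ω * a + (i : ℕ))) ∈
      box (applySeq simSeq m t) (applySeq simSeq m (t + 1)))
    (hg' : ∀ t c, g c (ω * a + (T t : ℕ)) = applySeq simSeq m t c) : TracksAll x g a := by
  have key : ∀ (c n : ℕ) (f : Ordinal.{0} → Bool), (∀ t, 0 < visits n t ∨ 0 < a →
      applySeq simSeq m t c = f (ω * a + (visits n t : ℕ))) → Tracks (g c) f a :=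
    fun c n f hf => tracks_of_applySeq (n := n) hT0 hT (fun t i h1 h2 => hg t i h1 h2 c)
      (fun t => hg' t c) hf
  have hst : ∀ (q : Program) t, 0 < visits q.index t ∨ 0 < a →
      applySeq simSeq m t (simStarted q.index) = true := fun q t ht =>
    ht.elim ((h.rep q).applySeq t).started fun ha => applySeq_simStarted (h.started ha q) t
  refine ⟨fun k => key _ 0 _ fun t _ => ?_, fun q r => key _ q.index _ fun t ht => ?_,
    fun q r => key _ q.index _ fun t _ => ((h.rep q).applySeq t).scratch r,
    fun q r => key _ q.index _ fun t _ => ((h.rep q).applySeq t).output r,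
    fun q => key _ q.index _ fun t _ => ((h.rep q).applySeq t).halt,
    fun q => key _ q.index _ (hst q), fun n hn => key _ 0 _ fun t _ => ?_⟩
  · rw [applySeq_inputCell, h.oracle]
  · rw [← ((h.rep q).applySeq t).input r]
    simp [load, hst q t ht]
  · rw [applySeq_outputCell hn, h.unused n hn]

theorem representsAll_zero (x : CantorReal) {m : ℕ → Bool} (hin : ∀ k, m (inputCell k) = x k)
    (hwork : ∀ k, m (workCell k) = false) (hout : ∀ k, m (outputCell k) = false) :
    RepresentsAll x 0 m := by
  refine ⟨hin, fun q => ?_, fun h => absurd h (lt_irrefl _), fun n _ => hout n⟩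
  rw [mul_zero, run_zero]
  have hst : m (simStarted q.index) = false := hwork _
  refine ⟨hin, fun h => ?_, fun h => hwork _, fun h => hwork _, ?_, le_rfl,
    fun h => absurd h (lt_irrefl _), fun _ _ h => hwork _, fun _ => ?_,
    fun h => absurd h (lt_irrefl _)⟩
  · simp [load, hst, initialConfig]
  · rw [hout, eq_comm, decide_eq_false_iff_not]
    exact State.start_ne_halt _
  · simp [loadControl, hst, initialConfig]

/-- Tracking in all earlier blocks makes the superior limits of the memory cells those of the
simulated tapes. The halting bit is right because halting persists, and the started bit then selects
the limit state for programs that have not halted. -/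
theorem representsAll_limit {x : CantorReal} {b : Ordinal.{0}} (hb : 0 < b) {m : ℕ → Bool}
    {g : ℕ → Ordinal.{0} → Bool}
    (hm : ∀ i, m i = true ↔ ∀ α < ω * b, ∃ β < ω * b, α ≤ β ∧ g i β = true)
    (h : ∀ a < b, TracksAll x g a) : RepresentsAll x b m := by
  have hl := isSuccLimit_omega0_mul hb
  have hconst : ∀ (i : ℕ) (v : Bool), (∀ a < b, Tracks (g i) (fun _ => v) a) → m i = v := by
    intro i v hi
    rw [Bool.eq_iff_iff, hm, Tracks.limsup hi]
    exact ⟨fun H => (H 0 hl.bot_lt).elim fun _ h => h.2.2, fun h α hα => ⟨α, hα, le_rfl, h⟩⟩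
  have hst : ∀ q : Program, m (simStarted q.index) = true := fun q =>
    hconst _ _ fun a ha => (h a ha).started q
  have hhalt : ∀ q : Program, m (outputCell q.index) =
      decide ((run q x (ofNat q.index) (ω * b)).state = State.halt q.1) := by
    intro q
    rw [Bool.eq_iff_iff, hm, Tracks.limsup fun a ha => (h a ha).halt q, decide_eq_true_eq]
    simp only [decide_eq_true_eq]
    constructor
    · intro H
      obtain ⟨β, hβ, -, hs⟩ := H 0 hl.bot_lt
      exact run_state_halt_of_le hβ.le hs
    · intro H α hα
      rw [run_limit _ _ _ hl] at H
      simp only [limitConfig] at H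
      split_ifs at H with hex
      · obtain ⟨β, hβ, hs⟩ := hex
        exact ⟨max α β, max_lt hα hβ, le_max_left _ _, run_state_halt_of_le (le_max_right _ _) hs⟩
      · exact absurd H (State.limit_ne_halt _)
  refine ⟨fun k => hconst _ _ fun a ha => (h a ha).oracle k, fun q => ?_, fun _ => hst,
    fun n hn => hconst _ _ fun a ha => (h a ha).unused n hn⟩
  refine ⟨fun k => hconst _ _ fun a ha => (h a ha).oracle k, fun r => ?_, fun r => ?_, fun r => ?_,
    hhalt q, ?_, fun h => absurd h (lt_irrefl _), fun _ h => ?_, fun _ => ?_,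
    fun h => absurd h (lt_irrefl _)⟩
  · simp only [load, hst, Bool.true_eq_false, and_false, if_false]
    rw [Bool.eq_iff_iff, hm, Tracks.limsup fun a ha => (h a ha).input q r, run_limit _ _ _ hl]
    simp only [limitConfig, limsupTape_eq_true, exists_prop]
  · rw [Bool.eq_iff_iff, hm, Tracks.limsup fun a ha => (h a ha).scratch q r, run_limit _ _ _ hl]
    simp only [limitConfig, limsupTape_eq_true, exists_prop]
  · rw [Bool.eq_iff_iff, hm, Tracks.limsup fun a ha => (h a ha).output q r, run_limit _ _ _ hl]
    simp only [limitConfig, limsupTape_eq_true, exists_prop]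
  · rw [run_limit _ _ _ hl]
    exact le_rfl
  · rw [hst q] at h
    exact absurd h (by simp)
  · simp only [loadControl, if_true, hst, hhalt, decide_eq_true_eq]
    split_ifs with h1
    · exact h1
    · rw [run_limit _ _ _ hl] at h1 ⊢
      simp only [limitConfig] at h1 ⊢
      split_ifs at h1 ⊢
      · exact absurd rfl h1
      · rfl

/-- The infinite time jump is eventually computable. -/
theorem eventuallyComputable_jump : EventuallyComputable jump := by
  classical
  obtain ⟨P, dec, hP, hstart, hlimit⟩ :=
    Table.exists_program streamTable.table (.read .init)
  choose N hN using exists_isLocal_simSeq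
  obtain ⟨z, hz⟩ := exists_oracle simSeq N hN
  refine ⟨P, z, fun x => ?_⟩
  set g : ℕ → Ordinal.{0} → Bool := fun i b => ((run P z x b).snapshot dec).mem i with hg
  -- Within one block the oracle's list is executed from its beginning, which turns a representation
  -- at the start into tracking throughout the block.
  have block : ∀ a, (run P z x (ω * a)).state ≠ State.halt P.1 →
      dec (run P z x (ω * a)).state = .read .init → (run P z x (ω * a)).head = 0 →
      RepresentsAll x a (fun i => g i (ω * a)) → TracksAll x g a ∧
        ∀ i : ℕ, (run P z x (ω * a + (i : ℕ))).state ≠ State.halt P.1 := by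
    intro a h1 h2 h3 h4
    obtain ⟨T, hT0, hT, hTg⟩ := hz ((run P z x (ω * a)).snapshot dec) h2 h3
    have hrun : ∀ i : ℕ, (fun c => g c (ω * a + (i : ℕ))) =
        ((streamTable.table.step z)^[i] ((run P z x (ω * a)).snapshot dec)).mem := fun i => by
      rw [← (hP.iterate z h1 i).2, ← run_add_nat]
    refine ⟨h4.tracksAll hT0 hT (fun t i hi hi' => ?_) fun t c => ?_, fun i => ?_⟩
    · rw [hrun]; exact (hTg t i hi hi').1
    · exact congrFun ((hrun _).trans ((hTg t _ le_rfl (hT.monotone (Nat.le_succ t))).2 rfl)) c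
    · rw [run_add_nat]; exact (hP.iterate z h1 i).1
  have main : ∀ a, TracksAll x g a ∧
      ∀ i : ℕ, (run P z x (ω * a + (i : ℕ))).state ≠ State.halt P.1 := by
    intro a
    induction a using WellFoundedLT.induction with
    | ind a ih =>
    rcases eq_or_ne a 0 with rfl | ha
    · have h0 : run P z x (ω * 0) = initialConfig P.1 x := by rw [mul_zero, run_zero]
      refine block 0 (by rw [h0]; exact State.start_ne_halt _) (by rw [h0]; exact hstart)
        (by rw [h0]; rfl) ?_
      have hm : (fun i => g i (ω * 0)) = ((initialConfig P.1 x).snapshot dec).mem := by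
        simp only [hg, h0]
      rw [hm]
      refine representsAll_zero x (fun k => ?_) (fun k => ?_) fun k => ?_
      · exact Snapshot.mem_inputCell _ k
      · exact Snapshot.mem_workCell _ k
      · exact Snapshot.mem_outputCell _ k
    · have ha0 : 0 < a := pos_iff_ne_zero.2 ha
      have hl := isSuccLimit_omega0_mul ha0
      have hst : (run P z x (ω * a)).state = State.limit P.1 := by
        rw [run_limit _ _ _ hl]
        refine if_neg ?_
        rintro ⟨β, hβ, hs⟩
        obtain ⟨a', i, rfl⟩ := exists_eq_omega0_mul_add β
        exact (ih a' (lt_of_omega0_mul_add_lt hβ)).2 i hs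
      refine block a (by rw [hst]; exact State.limit_ne_halt _) (by rw [hst]; exact hlimit)
        (by rw [run_limit _ _ _ hl]; rfl) ?_
      exact representsAll_limit ha0 (fun i => mem_run_limit dec z x hl i) fun a' ha' => (ih a' ha').1
  have hbound : ∃ A : Ordinal.{0}, ∀ q : Program, Halts q x (ofNat q.index) →
      (run q x (ofNat q.index) A).state = State.halt q.1 := by
    have : ∀ q : Program, ∃ a, Halts q x (ofNat q.index) →
        (run q x (ofNat q.index) a).state = State.halt q.1 := fun q => by
      by_cases h : Halts q x (ofNat q.index)
      · exact h.imp fun a ha _ => ha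
      · exact ⟨0, fun h' => absurd h' h⟩
    choose f hf using this
    exact ⟨⨆ q, f q, fun q hq => run_state_halt_of_le (Ordinal.le_iSup f q) (hf q hq)⟩
  obtain ⟨A, hA⟩ := hbound
  -- The stages considered then lie in a block `a > 0`, where `Tracks.all` holds, and every
  -- simulated stage of that block is at least `A`.
  refine ⟨ω * (A + 1), fun b hb => ?_⟩
  obtain ⟨a, i, rfl⟩ := exists_eq_omega0_mul_add b
  have hAa : A + 1 ≤ a := by
    rcases omega0_mul_add_le (n := 0) (by simpa using hb) with h | h
    · exact h.le
    · exact h.1.le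
  have ha0 : 0 < a := lt_of_lt_of_le (by simp) hAa
  have hAle : ∀ j : ℕ, A ≤ ω * a + (j : ℕ) := fun j =>
    (le_self_add.trans hAa).trans ((le_mul_right a omega0_pos).trans le_self_add)
  funext n
  have hout : (run P z x (ω * a + (i : ℕ))).output n = g (outputCell n) (ω * a + (i : ℕ)) :=
    (Snapshot.mem_outputCell ((run P z x (ω * a + (i : ℕ))).snapshot dec) n).symm
  rw [hout]
  by_cases hn : ∃ q : Program, q.index = n
  · obtain ⟨q, rfl⟩ := hn
    obtain ⟨j, hj⟩ := ((main a).1.halt q).all ha0 i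
    rw [hj, jump, Bool.eq_iff_iff, decide_eq_true_eq, decide_eq_true_eq]
    constructor
    · exact fun h => ⟨q, rfl, _, h⟩
    · rintro ⟨p, hp, hh⟩
      obtain rfl := Encodable.encode_injective hp
      exact run_state_halt_of_le (hAle j) (hA _ hh)
  · obtain ⟨j, hj⟩ := ((main a).1.unused n fun q hq => hn ⟨q, hq⟩).all ha0 i
    rw [hj, jump, eq_comm, decide_eq_false_iff_not]
    rintro ⟨p, hp, -⟩
    exact hn ⟨p, hp⟩

end ITTM

theorem mainTheorem6 :
    ITTM.EventuallyReducible ITTM.JumpEquiv ITTM.InfEquiv ∧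
      ITTM.EventuallyReducibleBy ITTM.jump ITTM.JumpEquiv ITTM.InfEquiv := by
  have h : ITTM.EventuallyReducibleBy ITTM.jump ITTM.JumpEquiv ITTM.InfEquiv :=
    -- The equivalence is the definition of $J$.
    ⟨ITTM.eventuallyComputable_jump, fun _ _ => Iff.rfl⟩
  exact ⟨⟨_, h⟩, h⟩
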